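/- Let $d\ge 1$, $m\le d$, and let $I_1,\dots,I_m\subset\{1,\dots,d\}$ be pairwise disjoint with $I_1\cup\dots\cup I_m=\{1,\dots,d\}$. For each $j\in\{1,\dots,m\}$ let $Z^j=(Z^j(t))_{t\ge0}$ be a Lévy process in $\mathbb{R}^{I_j}\cong\mathbb{R}^{|I_j|}$ with Lévy measure $\nu_j$ and symbol $$\Psi_{\nu_j}(\xi)=\int_{\mathbb{R}^{I_j}}\left(1+i\mathbf 1_{\{|z|\le1\}}(\xi\cdot z)-e^{i\xi\cdot z}\right)\nu_j(dz),\qquad \mathbb{E}\big[e^{i\xi\cdot Z^j(t)}\big]=e^{-t\Psi_{\nu_j}(\xi)} .$$ Suppose that the processes $Z^1,\dots,Z^m$ are independent and that there are $\alpha_1,\dots,\alpha_m\in(0,2)$, constants $c,C_0>0$ and $R\in\mathbb{R}$ such that, for every $j$, $$c|\xi|^{\alpha_j}\le\mathrm{Re}\,\Psi_{\nu_j}(\xi)\le C_0|\xi|^{\alpha_j}\qquad\text{for all }\xi\in\mathbb{R}^{I_j}\text{ with }|\xi|\ge R .$$ Let $Z=(Z^1,\dots,Z^m)$ be the $\mathbb{R}^d$-valued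 process whose coordinates with index in $I_j$ are those of $Z^j$. Then, for each $t>0$, $Z(t)$ has a density $f_t\in C^\infty(\mathbb{R}^d)$, and there is a constant $C>0$ such that, for every $j\in\{1,\dots,m\}$ and all sufficiently small $t>0$, the partial gradient $\nabla_{I_j}f_t=(\partial f_t/\partial z_k)_{k\in I_j}$ is integrable and $$\int_{\mathbb{R}^d}|\nabla_{I_j}f_t(z)|\,dz\le C\,t^{-1/\alpha_j}.$$ In particular, $Z$ satisfies the following condition (A1) with the exponents $a_k=\alpha_j$ for $k\in I_j$: for each $t>0$, $Z(t)$ has a density $f_t$, and there are $a_1,\dots,a_d\in(0,2)$ and a constant $C>0$ such that, for every $k\in\{1,\dots,d\}$ and every $h\in\mathbb{R}$, $$\limsup_{t\to0}\,t^{1/a_k}\int_{\mathbb{R}^d}|f_t(z+he_k)-f_t(z)|\,dz\le C|h| ,$$ where $e_k$ is the $k$-th standard basis vector. -/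

import Mathlib

open MeasureTheory ProbabilityTheory Filter Topology
open scoped NNReal ENNReal

namespace AnisoLevy

noncomputable section

/-- A Lévy process: random variables `Z t`, `t ≥ 0`, with `Z 0 = 0` almost surely, independent and
stationary increments, and stochastic continuity. -/
structure IsLevyProcess {Ω E : Type*} [MeasurableSpace Ω] [NormedAddCommGroup E]
    [MeasurableSpace E] (P : Measure Ω) (Z : ℝ≥0 → Ω → E) : Prop where
  measurable : ∀ t, Measurable (Z t)
  zero : ∀ᵐ ω ∂P, Z 0 ω = 0
  indep : HasIndepIncrements Z P
  stationary : ∀ s t : ℝ≥0, IdentDistrib (fun ω => Z (s + t) ω - Z s ω) (Z t) P P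
  stochCont : ∀ t : ℝ≥0, TendstoInMeasure P Z (𝓝 t) (Z t)

/-- A Lévy measure: no mass at the origin, and `∫ min(1, |z|²) ν(dz) < ∞`. -/
def IsLevyMeasure {E : Type*} [NormedAddCommGroup E] [MeasurableSpace E] (ν : Measure E) : Prop :=
  ν {0} = 0 ∧ ∫⁻ z, ENNReal.ofReal (min 1 (‖z‖ ^ 2)) ∂ν < ∞

/-- The symbol `Ψ_ν(ξ) = ∫ (1 + i 1_{|z| ≤ 1} (ξ · z) - e^{i (ξ · z)}) ν(dz)`. The integrand is
`ν`-integrable whenever `ν` is a Lévy measure. -/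
def symbol {E : Type*} [NormedAddCommGroup E] [InnerProductSpace ℝ E] [MeasurableSpace E]
    (ν : Measure E) (ξ : E) : ℂ :=
  ∫ z, (1 + (if ‖z‖ ≤ 1 then Complex.I * (inner ℝ ξ z : ℂ) else 0)
    - Complex.exp (Complex.I * (inner ℝ ξ z : ℂ))) ∂ν

/-- `Z` is a pure jump Lévy process with Lévy measure `ν`, that is,
`E[e^{i ξ · Z(t)}] = e^{-t Ψ_ν(ξ)}` for all `t ≥ 0` and all `ξ`. -/
structure IsPureJumpLevy {Ω E : Type*} [MeasurableSpace Ω] [NormedAddCommGroup E]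
    [InnerProductSpace ℝ E] [MeasurableSpace E] (P : Measure Ω) (Z : ℝ≥0 → Ω → E)
    (ν : Measure E) : Prop where
  isLevyProcess : IsLevyProcess P Z
  isLevyMeasure : IsLevyMeasure ν
  charFun_eq : ∀ (t : ℝ≥0) (ξ : E),
    charFun (P.map (Z t)) ξ = Complex.exp (-((t : ℝ) : ℂ) * symbol ν ξ)

/-- `f` is a (nonnegative, measurable) probability density of the random vector `X` with respect to
Lebesgue measure. -/
structure IsDensity {Ω : Type*} [MeasurableSpace Ω] {d : ℕ} (P : Measure Ω)
    (X : Ω → EuclideanSpace ℝ (Fin d)) (f : EuclideanSpace ℝ (Fin d) → ℝ) : Prop where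
  measurable : Measurable f
  nonneg : ∀ z, 0 ≤ f z
  hasLaw : HasLaw X (volume.withDensity fun z => ENNReal.ofReal (f z)) P

/-- Condition (A1) with the exponents `a 1, …, a d`: these lie in `(0,2)`, `Z t` has a density
`f t` for each `t > 0`, and there is `C > 0` such that, for each `k` and each `h`,
`limsup_{t → 0} t^{1 / a k} ∫ |f t (z + h e_k) - f t z| dz ≤ C |h|`. -/
def ConditionA1With {Ω : Type*} [MeasurableSpace Ω] {d : ℕ} (P : Measure Ω)
    (Z : ℝ≥0 → Ω → EuclideanSpace ℝ (Fin d)) (a : Fin d → ℝ) : Prop :=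
  (∀ k, a k ∈ Set.Ioo (0 : ℝ) 2) ∧
  ∃ f : ℝ≥0 → EuclideanSpace ℝ (Fin d) → ℝ,
    (∀ t, 0 < t → IsDensity P (Z t) (f t)) ∧
    ∃ C : ℝ, 0 < C ∧ ∀ (k : Fin d) (h : ℝ),
      limsup (fun t : ℝ≥0 => ENNReal.ofReal ((t : ℝ) ^ (1 / a k)) *
        ∫⁻ z, ENNReal.ofReal |f t (z + EuclideanSpace.single k h) - f t z|) (𝓝[>] 0)
        ≤ ENNReal.ofReal (C * |h|)

/-- The partial gradient `∇_J f = (∂f/∂z_k)_{k ∈ J}`. -/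
def partialGrad {d : ℕ} (J : Finset (Fin d)) (f : EuclideanSpace ℝ (Fin d) → ℝ)
    (z : EuclideanSpace ℝ (Fin d)) : EuclideanSpace ℝ J :=
  WithLp.toLp 2 fun k : J => fderiv ℝ f z (EuclideanSpace.single (k : Fin d) 1)

/-- The vector of `ℝ^d` with the blocks `x j ∈ ℝ^{I j}`, when the `I j` are disjoint and cover the
index set. -/
def ofBlocks {d m : ℕ} (I : Fin m → Finset (Fin d)) (x : ∀ j, EuclideanSpace ℝ (I j)) :
    EuclideanSpace ℝ (Fin d) :=
  WithLp.toLp 2 fun k => ∑ j, if h : k ∈ I j then x j ⟨k, h⟩ else 0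

theorem ofBlocks_apply {d m : ℕ} {I : Fin m → Finset (Fin d)}
    (hI : Pairwise fun i j => Disjoint (I i) (I j)) (x : ∀ j, EuclideanSpace ℝ (I j))
    (j : Fin m) (k : I j) : ofBlocks I x (k : Fin d) = x j k := by
  have h : ∀ i, i ≠ j → (k : Fin d) ∉ I i := fun i hij hk =>
    Finset.disjoint_left.mp (hI hij) hk k.2
  change (∑ i, if h : (k : Fin d) ∈ I i then x i ⟨k, h⟩ else 0) = x j k
  rw [Finset.sum_eq_single j]
  · simp
  · intro i _ hij
    simp [h i hij]
  · simp

end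

end AnisoLevy

open AnisoLevy

/-!
Everything is read off from characteristic functions. By independence `Z t` has the characteristic
function `exp (-t Ψ)` on `ℝ^d`, where `Ψ` is the symbol of the sum of the Lévy measures `ν j`, each
carried by its coordinate subspace (`symbol_blockLevyMeasure`, `charFun_map_ofBlocks`). With
`a k = α j` for `k ∈ I j`, the hypotheses give `re Ψ ξ ≥ c' ∑ |ξ_k|^{a_k} - K` everywhere, and
`re Ψ ≤ C₀ s^{a_k}` at the point `s e_k` of the `k`-th axis, for large `s`.

For small `t`, let `S` be the diagonal matrix with entries `t^{-1/a_k}`, and cut the jumps at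
`|S z| = 1`. The large jumps contribute to `exp (-t Ψ)` the characteristic function of a probability
measure, a shifted compound Poisson law (`exists_exp_symbol_eq_charFun_mul`), and convolution with a
probability measure does not increase `L¹` norms (`integrable_fourier_charFun_mul`). The small jumps
contribute `exp (-Ψ_N (S⁻¹ ξ))`, where `N` is the rescaled measure of small jumps, which lives on
the unit ball. The upper bound on the axes makes the second moment of `N` and the rescaled mass of
the large jumps bounded uniformly in `t` (`setIntegral_norm_sq_le`, `measureReal_compl_le`); with
the lower bound, `exp (-re Ψ_N)` decays faster than any power, uniformly in `t`. All derivatives of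
`Ψ_N` of order at least two are bounded by the second moment, because `N` lives on the unit ball, so
the functions `exp (-Ψ_N)` form a bounded subset of the Schwartz space. Hence `∂_k 𝓕 (exp (-Ψ_N))`
is bounded in `L¹` uniformly in `t` (`exists_integral_lineDeriv_fourier_expSymbol_le`), and undoing
the scaling gives the factor `t^{-1/a_k}` (`exists_smooth_density_of_symbol_bounds`).

That the Fourier transform of `exp (-t Ψ)` is a nonnegative density is Fourier inversion
(`eq_withDensity_of_integrable_charFun`), and the bound on translates follows from the one on the
derivatives by integrating along segments (`lintegral_translate_sub_le`).
-/

namespace AnisoLevy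

open scoped FourierTransform RealInnerProductSpace SchwartzMap

/-! ### Fourier transforms: convolution and linear changes of variables -/

section Multiplier

variable {V : Type*} [NormedAddCommGroup V] [InnerProductSpace ℝ V] [FiniteDimensional ℝ V]
  [MeasurableSpace V] [BorelSpace V]

/-- Multiplication by a characteristic function is convolution with the measure. -/
theorem fourier_charFun_mul (π : Measure V) [IsFiniteMeasure π] {φ : V → ℂ} (hφ : Integrable φ)
    (x : V) :
    𝓕 (fun η => charFun π ((2 * Real.pi) • η) * φ η) x = ∫ y, 𝓕 φ (x - y) ∂π := by
  simp_rw [Real.fourier_eq', charFun_apply, smul_eq_mul]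
  have hint : Integrable (Function.uncurry fun (y η : V) =>
      Complex.exp (((-2 * Real.pi * ⟪η, x - y⟫ : ℝ) : ℂ) * Complex.I) * φ η) (π.prod volume) := by
    refine (hφ.comp_snd π).bdd_mul (c := 1) ?_ ?_
    · exact Continuous.aestronglyMeasurable (by fun_prop)
    · exact Filter.Eventually.of_forall fun p => (Complex.norm_exp_ofReal_mul_I _).le
  rw [integral_integral_swap hint]
  refine integral_congr_ae (Filter.Eventually.of_forall fun η => ?_)
  simp only
  rw [integral_mul_const, ← mul_assoc, ← integral_const_mul]
  congr 1
  refine integral_congr_ae (Filter.Eventually.of_forall fun y => ?_)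
  simp only
  rw [← Complex.exp_add]
  congr 1
  rw [inner_smul_right, inner_sub_right, real_inner_comm y η]
  push_cast
  ring

/-- Convolution with a probability measure does not increase the `L¹` norm; here on the Fourier
side, where it is multiplication by a characteristic function. -/
theorem integrable_fourier_charFun_mul (π : Measure V) [IsProbabilityMeasure π] {φ : V → ℂ}
    (hφ : Integrable φ) (hφ' : Integrable (𝓕 φ)) :
    Integrable (𝓕 fun η => charFun π ((2 * Real.pi) • η) * φ η) ∧
      ∫ x, ‖𝓕 (fun η => charFun π ((2 * Real.pi) • η) * φ η) x‖ ≤ ∫ x, ‖𝓕 φ x‖ := by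
  rw [show (𝓕 fun η => charFun π ((2 * Real.pi) • η) * φ η) = fun x => ∫ y, 𝓕 φ (x - y) ∂π from
    funext (fourier_charFun_mul π hφ)]
  have hcont : Continuous (𝓕 φ) :=
    VectorFourier.fourierIntegral_continuous Real.continuous_fourierChar
      (by exact continuous_inner) hφ
  have hmeas : AEStronglyMeasurable (Function.uncurry fun (x y : V) => 𝓕 φ (x - y))
      (volume.prod π) := Continuous.aestronglyMeasurable (by
        change Continuous fun p : V × V => 𝓕 φ (p.1 - p.2)
        fun_prop)
  have hint : Integrable (Function.uncurry fun (x y : V) => 𝓕 φ (x - y)) (volume.prod π) := by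
    rw [integrable_prod_iff' hmeas]
    refine ⟨Filter.Eventually.of_forall fun y => hφ'.comp_sub_right y, ?_⟩
    have : (fun y : V => ∫ x, ‖Function.uncurry (fun (x y : V) => 𝓕 φ (x - y)) (x, y)‖)
        = fun _ => ∫ x, ‖𝓕 φ x‖ := by
      ext y
      exact integral_sub_right_eq_self (fun x => ‖𝓕 φ x‖) y
    rw [this]
    exact integrable_const _
  refine ⟨hint.integral_prod_left, ?_⟩
  calc ∫ x, ‖∫ y, 𝓕 φ (x - y) ∂π‖ ≤ ∫ x, ∫ y, ‖𝓕 φ (x - y)‖ ∂π :=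
        integral_mono hint.integral_prod_left.norm hint.norm.integral_prod_left
          fun x => norm_integral_le_integral_norm _
    _ = ∫ y, (∫ x, ‖𝓕 φ (x - y)‖) ∂π := integral_integral_swap hint.norm
    _ = ∫ y, (∫ x, ‖𝓕 φ x‖) ∂π :=
        integral_congr_ae (Filter.Eventually.of_forall fun y =>
          integral_sub_right_eq_self (fun x => ‖𝓕 φ x‖) y)
    _ = ∫ x, ‖𝓕 φ x‖ := by simp

theorem map_linearEquiv_volume (A : V ≃L[ℝ] V) :
    (volume : Measure V).map A
      = ENNReal.ofReal |(LinearMap.det (A.toLinearEquiv : V →ₗ[ℝ] V))⁻¹| • volume :=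
  Measure.map_linearMap_addHaar_eq_smul_addHaar volume (f := (A.toLinearEquiv : V →ₗ[ℝ] V))
    (LinearEquiv.isUnit_det' A.toLinearEquiv).ne_zero

theorem fourier_comp_symmetric (A : V ≃L[ℝ] V) (hA : ∀ v w, ⟪A v, w⟫ = ⟪v, A w⟫)
    (φ : V → ℂ) (w : V) :
    𝓕 (fun η => φ (A η)) w =
      |(LinearMap.det (A.toLinearEquiv : V →ₗ[ℝ] V))⁻¹| • 𝓕 φ (A.symm w) := by
  simp_rw [Real.fourier_eq']
  have h := integral_map_equiv (μ := volume) A.toHomeomorph.toMeasurableEquiv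
    (fun v => Complex.exp (((-2 * Real.pi * ⟪v, A.symm w⟫ : ℝ) : ℂ) * Complex.I) • φ v)
  have hm : (volume : Measure V).map A.toHomeomorph.toMeasurableEquiv
      = ENNReal.ofReal |(LinearMap.det (A.toLinearEquiv : V →ₗ[ℝ] V))⁻¹| • volume :=
    map_linearEquiv_volume A
  rw [hm, integral_smul_measure, ENNReal.toReal_ofReal (abs_nonneg _)] at h
  rw [h]
  refine integral_congr_ae (Filter.Eventually.of_forall fun v => ?_)
  simp [hA]

/-- The `L¹` norm of the Fourier transform is invariant under a symmetric linear change of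
variables. -/
theorem integrable_fourier_comp_symmetric (A : V ≃L[ℝ] V) (hA : ∀ v w, ⟪A v, w⟫ = ⟪v, A w⟫)
    {φ : V → ℂ} (hφ' : Integrable (𝓕 φ)) :
    Integrable (𝓕 fun η => φ (A η)) ∧
      ∫ x, ‖𝓕 (fun η => φ (A η)) x‖ = ∫ x, ‖𝓕 φ x‖ := by
  set c := |(LinearMap.det (A.toLinearEquiv : V →ₗ[ℝ] V))⁻¹| with hc
  have hdet : LinearMap.det (A.toLinearEquiv : V →ₗ[ℝ] V) ≠ 0 :=
    (LinearEquiv.isUnit_det' A.toLinearEquiv).ne_zero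
  have hc0 : 0 < c := abs_pos.mpr (inv_ne_zero hdet)
  have hfun : (𝓕 fun η => φ (A η)) = fun w => c • 𝓕 φ (A.symm w) :=
    funext (fourier_comp_symmetric A hA φ)
  -- the change of variables `w = A u` cancels the factor `|det A|⁻¹`
  have hm : (volume : Measure V).map A.toHomeomorph.toMeasurableEquiv
      = ENNReal.ofReal c • volume := map_linearEquiv_volume A
  have hm' : (volume : Measure V) = ENNReal.ofReal c •
      (volume : Measure V).map A.symm.toHomeomorph.toMeasurableEquiv := by
    have h1 : ((volume : Measure V).map A.toHomeomorph.toMeasurableEquiv).map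
        A.symm.toHomeomorph.toMeasurableEquiv = volume := by
      rw [Measure.map_map (MeasurableEquiv.measurable _) (MeasurableEquiv.measurable _)]
      have : (A.symm.toHomeomorph.toMeasurableEquiv ∘ A.toHomeomorph.toMeasurableEquiv : V → V)
          = id := by
        ext v
        exact A.symm_apply_apply v
      rw [this, Measure.map_id]
    rw [← Measure.map_smul, ← hm, h1]
  rw [hfun]
  constructor
  · refine Integrable.smul c ?_
    rw [hm'] at hφ'
    rw [integrable_smul_measure (by simpa using hc0) ENNReal.ofReal_ne_top] at hφ'
    exact (integrable_map_equiv _ _).mp hφ'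
  · conv_rhs => rw [hm']
    rw [integral_smul_measure, ENNReal.toReal_ofReal hc0.le, integral_map_equiv,
      smul_eq_mul, ← integral_const_mul]
    refine integral_congr_ae (Filter.Eventually.of_forall fun v => ?_)
    simp only [norm_smul, Real.norm_eq_abs, abs_of_pos hc0]
    rfl

end Multiplier

/-! ### Densities from integrable characteristic functions -/

section Density

variable {V : Type*} [NormedAddCommGroup V] [InnerProductSpace ℝ V] [FiniteDimensional ℝ V]
  [MeasurableSpace V] [BorelSpace V]

theorem charFun_withDensity_ofReal {g : V → ℝ} (hg : Measurable g) (hg0 : ∀ x, 0 ≤ g x) (ξ : V) :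
    charFun (volume.withDensity fun x => ENNReal.ofReal (g x)) ξ
      = ∫ x, Complex.exp (⟪x, ξ⟫ * Complex.I) * (g x : ℂ) := by
  rw [charFun_apply]
  have h := integral_withDensity_eq_integral_smul (μ := (volume : Measure V))
    (hg.real_toNNReal) (fun x : V => Complex.exp (⟪x, ξ⟫ * Complex.I))
  refine h.trans (integral_congr_ae (Filter.Eventually.of_forall fun x => ?_))
  simp only [NNReal.smul_def, Real.coe_toNNReal _ (hg0 x), Complex.real_smul]
  ring

/-- Fourier inversion for probability measures: if the characteristic function and its Fourier
transform are integrable, then the real part of the latter is a density. -/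
theorem eq_withDensity_of_integrable_charFun (μ : Measure V) [IsProbabilityMeasure μ]
    {Φ : V → ℂ} (hΦ : ∀ η, charFun μ ((2 * Real.pi) • η) = Φ η)
    (hint : Integrable Φ) (hint' : Integrable (𝓕 Φ)) :
    (∀ x, 0 ≤ (𝓕 Φ x).re) ∧
      μ = volume.withDensity fun x => ENNReal.ofReal (𝓕 Φ x).re := by
  have hcΦ : Continuous Φ := by
    rw [← funext hΦ]
    exact continuous_charFun.comp (continuous_const_smul _)
  have hcont : Continuous (𝓕 Φ) :=
    VectorFourier.fourierIntegral_continuous Real.continuous_fourierChar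
      (by exact continuous_inner) hint
  set g : V → ℝ := fun x => (𝓕 Φ x).re with hg
  have hgc : Continuous g := Complex.continuous_re.comp hcont
  have hgi : Integrable g := hint'.re
  -- inversion, first for the complex function `𝓕 Φ`
  have hinv : ∀ ξ, ∫ x, Complex.exp (⟪x, ξ⟫ * Complex.I) * 𝓕 Φ x = charFun μ ξ := by
    intro ξ
    have h := congrFun (hcΦ.fourierInv_fourier_eq hint hint') ((2 * Real.pi)⁻¹ • ξ)
    rw [← hΦ, smul_inv_smul₀ (by positivity), Real.fourierInv_eq'] at h
    rw [← h]
    refine integral_congr_ae (Filter.Eventually.of_forall fun x => ?_)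
    simp only [smul_eq_mul, inner_smul_right]
    congr 4
    field_simp
  have hexp : ∀ (ξ : V) {u : V → ℂ}, Integrable u →
      Integrable fun x => Complex.exp (⟪x, ξ⟫ * Complex.I) * u x := by
    intro ξ u hu
    refine hu.bdd_mul (c := 1) (Continuous.aestronglyMeasurable (by fun_prop))
      (Filter.Eventually.of_forall fun x => ?_)
    exact (Complex.norm_exp_ofReal_mul_I _).le
  -- the characteristic function of a measure is Hermitian, so that `re (𝓕 Φ)` has the same inverse
  -- transform as `𝓕 Φ`
  have hre : ∀ ξ, ∫ x, Complex.exp (⟪x, ξ⟫ * Complex.I) * (g x : ℂ) = charFun μ ξ := by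
    intro ξ
    have h2 : ∫ x, Complex.exp (⟪x, ξ⟫ * Complex.I) * (starRingEnd ℂ) (𝓕 Φ x)
        = charFun μ ξ := by
      rw [← neg_neg ξ, charFun_neg, ← hinv (-ξ), ← integral_conj]
      refine integral_congr_ae (Filter.Eventually.of_forall fun x => ?_)
      simp [← Complex.exp_conj]
    have h3 : ∀ x, Complex.exp (⟪x, ξ⟫ * Complex.I) * (g x : ℂ)
        = 2⁻¹ * (Complex.exp (⟪x, ξ⟫ * Complex.I) * 𝓕 Φ x
          + Complex.exp (⟪x, ξ⟫ * Complex.I) * (starRingEnd ℂ) (𝓕 Φ x)) := by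
      intro x
      rw [← mul_add, Complex.add_conj]
      push_cast
      simp only [hg]
      ring
    simp_rw [h3]
    have hconj : Integrable fun x => (starRingEnd ℂ) (𝓕 Φ x) :=
      (RCLike.conjLIE (K := ℂ)).integrable_comp_iff.mpr hint'
    rw [integral_const_mul, integral_add (hexp ξ hint') (hexp ξ hconj), h2, hinv]
    ring
  -- compare characteristic functions in `μ + g⁻ = g⁺`
  set p : V → ℝ := fun x => max (g x) 0
  set q : V → ℝ := fun x => max (-g x) 0
  have hpq : ∀ x, p x - q x = g x := fun x => max_zero_sub_max_neg_zero_eq_self (g x)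
  have hpm : Measurable p := (hgc.max continuous_const).measurable
  have hqm : Measurable q := (hgc.neg.max continuous_const).measurable
  have hpi : Integrable p := hgi.pos_part
  have hqi : Integrable q := hgi.neg_part
  have : IsFiniteMeasure (volume.withDensity fun x => ENNReal.ofReal (p x)) :=
    isFiniteMeasure_withDensity_ofReal hpi.2
  have : IsFiniteMeasure (volume.withDensity fun x => ENNReal.ofReal (q x)) :=
    isFiniteMeasure_withDensity_ofReal hqi.2
  have hkey : μ + (volume.withDensity fun x => ENNReal.ofReal (q x))
      = volume.withDensity fun x => ENNReal.ofReal (p x) := by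
    refine Measure.ext_of_charFun (funext fun ξ => ?_)
    have hadd : charFun (μ + (volume.withDensity fun x => ENNReal.ofReal (q x))) ξ
        = charFun μ ξ + charFun (volume.withDensity fun x => ENNReal.ofReal (q x)) ξ := by
      simp only [charFun_apply]
      have hb : ∀ (ρ : Measure V) [IsFiniteMeasure ρ],
          Integrable (fun x : V => Complex.exp (⟪x, ξ⟫ * Complex.I)) ρ := fun ρ _ =>
        (integrable_const (1 : ℝ)).mono' (Continuous.aestronglyMeasurable (by fun_prop))
          (Filter.Eventually.of_forall fun x => (Complex.norm_exp_ofReal_mul_I _).le)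
      exact integral_add_measure (hb _) (hb _)
    rw [hadd, charFun_withDensity_ofReal hqm (fun x => le_max_right _ _),
      charFun_withDensity_ofReal hpm (fun x => le_max_right _ _), ← hre, ← integral_add
        (hexp ξ (u := fun x => (g x : ℂ)) hgi.ofReal)
        (hexp ξ (u := fun x => (q x : ℂ)) hqi.ofReal)]
    refine integral_congr_ae (Filter.Eventually.of_forall fun x => ?_)
    simp only [← hpq x]
    push_cast
    ring
  -- where `g < 0` the right-hand side vanishes, so `g ≥ 0` almost everywhere
  have hneg : ∀ x, 0 ≤ g x := by
    have hopen : IsOpen {x | g x < 0} := isOpen_lt hgc continuous_const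
    have h0 : (volume.withDensity fun x => ENNReal.ofReal (q x)) {x | g x < 0} = 0 := by
      have h1 : (volume.withDensity fun x => ENNReal.ofReal (p x)) {x | g x < 0} = 0 := by
        rw [withDensity_apply _ hopen.measurableSet,
          setLIntegral_congr_fun (g := fun _ => 0) hopen.measurableSet]
        · simp
        · intro x hx
          have hx' : g x < 0 := hx
          simp [p, hx'.le]
      rw [← hkey, Measure.add_apply] at h1
      exact (add_eq_zero.mp h1).2
    have h2 : volume {x | g x < 0} = 0 := by
      rw [withDensity_apply _ hopen.measurableSet, lintegral_eq_zero_iff hqm.ennreal_ofReal,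
        Filter.EventuallyEq, ae_restrict_iff' hopen.measurableSet] at h0
      refine measure_mono_null (fun x hx => ?_) h0
      simp only [Set.mem_compl_iff, Set.mem_ofPred_eq, Classical.not_imp, Pi.zero_apply,
        ENNReal.ofReal_eq_zero, not_le]
      exact ⟨hx, lt_max_of_lt_left (neg_pos.mpr hx)⟩
    intro x
    by_contra hx
    have h3 := hopen.measure_eq_zero_iff volume |>.mp h2
    exact (h3 ▸ (show x ∈ {x | g x < 0} from not_le.mp hx) : x ∈ (∅ : Set V))
  refine ⟨hneg, ?_⟩
  have hq0 : q = fun _ => 0 := by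
    ext x
    simp [q, hneg x]
  have hp0 : p = g := by
    ext x
    simp [p, hneg x]
  rw [hq0, hp0] at hkey
  simpa using hkey

end Density

/-! ### Compound Poisson laws -/

section CompoundPoisson

variable {V : Type*} [NormedAddCommGroup V] [InnerProductSpace ℝ V] [FiniteDimensional ℝ V]
  [MeasurableSpace V] [BorelSpace V]

/-- The convolution powers `ρ^{*n}` of a measure. -/
noncomputable def convPow (ρ : Measure V) : ℕ → Measure V
  | 0 => Measure.dirac 0
  | n + 1 => (convPow ρ n).conv ρ

instance isFiniteMeasure_convPow (ρ : Measure V) [IsFiniteMeasure ρ] (n : ℕ) :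
    IsFiniteMeasure (convPow ρ n) := by
  induction n with
  | zero => rw [convPow]; infer_instance
  | succ n ih => rw [convPow]; infer_instance

theorem charFun_convPow (ρ : Measure V) [IsFiniteMeasure ρ] (n : ℕ) (ξ : V) :
    charFun (convPow ρ n) ξ = charFun ρ ξ ^ n := by
  induction n with
  | zero => simp [convPow, charFun_dirac]
  | succ n ih => rw [convPow, charFun_conv, ih, pow_succ]

theorem convPow_univ (ρ : Measure V) [IsFiniteMeasure ρ] (n : ℕ) :
    convPow ρ n Set.univ = ρ Set.univ ^ n := by
  have h := charFun_convPow ρ n 0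
  rw [charFun_zero, charFun_zero] at h
  have h' : (convPow ρ n).real Set.univ = ρ.real Set.univ ^ n := by exact_mod_cast h
  rw [← ofReal_measureReal, h', ENNReal.ofReal_pow measureReal_nonneg, ofReal_measureReal]

/-- The compound Poisson law with jump measure `ρ`, that is `e^{-ρ(V)} ∑ ρ^{*n} / n!`. -/
noncomputable def compoundPoisson (ρ : Measure V) : Measure V :=
  Measure.sum fun n : ℕ =>
    ENNReal.ofReal (Real.exp (-ρ.real Set.univ) / n.factorial) • convPow ρ n

instance isProbabilityMeasure_compoundPoisson (ρ : Measure V) [IsFiniteMeasure ρ] :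
    IsProbabilityMeasure (compoundPoisson ρ) := by
  constructor
  rw [compoundPoisson, Measure.sum_apply _ MeasurableSet.univ]
  have h : ∀ n : ℕ, (ENNReal.ofReal (Real.exp (-ρ.real Set.univ) / n.factorial) • convPow ρ n)
      Set.univ = ENNReal.ofReal
        (Real.exp (-ρ.real Set.univ) * (ρ.real Set.univ ^ n / n.factorial)) := by
    intro n
    rw [Measure.smul_apply, convPow_univ, smul_eq_mul, ← ofReal_measureReal,
      ← ENNReal.ofReal_pow measureReal_nonneg, ← ENNReal.ofReal_mul (by positivity)]
    congr 1
    ring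
  simp_rw [h]
  have hs := (NormedSpace.expSeries_div_hasSum_exp (ρ.real Set.univ)).mul_left
    (Real.exp (-ρ.real Set.univ))
  rw [← ENNReal.ofReal_tsum_of_nonneg (fun n => by positivity) hs.summable, hs.tsum_eq,
    ← Real.exp_eq_exp_ℝ, ← Real.exp_add]
  simp

theorem charFun_compoundPoisson (ρ : Measure V) [IsFiniteMeasure ρ] (ξ : V) :
    charFun (compoundPoisson ρ) ξ = Complex.exp (charFun ρ ξ - ρ.real Set.univ) := by
  rw [charFun_apply]
  have hint : Integrable (fun x : V => Complex.exp (⟪x, ξ⟫ * Complex.I)) (compoundPoisson ρ) :=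
    (integrable_const (1 : ℝ)).mono' (Continuous.aestronglyMeasurable (by fun_prop))
      (Filter.Eventually.of_forall fun x => (Complex.norm_exp_ofReal_mul_I _).le)
  rw [compoundPoisson] at hint ⊢
  rw [integral_sum_measure hint]
  have h : ∀ n : ℕ, ∫ x, Complex.exp (⟪x, ξ⟫ * Complex.I)
      ∂(ENNReal.ofReal (Real.exp (-ρ.real Set.univ) / n.factorial) • convPow ρ n)
      = Complex.exp (-(ρ.real Set.univ : ℂ)) * (charFun ρ ξ ^ n / n.factorial) := by
    intro n
    rw [integral_smul_measure, ← charFun_apply, charFun_convPow,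
      ENNReal.toReal_ofReal (by positivity), Complex.real_smul]
    push_cast
    ring
  simp_rw [h]
  rw [((NormedSpace.expSeries_div_hasSum_exp (charFun ρ ξ)).mul_left _).tsum_eq,
    ← Complex.exp_eq_exp_ℂ, ← Complex.exp_add]
  congr 1
  ring

end CompoundPoisson

/-! ### Translates of a differentiable function -/

section Translation

variable {V : Type*} [NormedAddCommGroup V] [InnerProductSpace ℝ V] [FiniteDimensional ℝ V]
  [MeasurableSpace V] [BorelSpace V]

/-- By the fundamental theorem of calculus along `z + s v`, `0 ≤ s ≤ 1`, and translation invariance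
of Lebesgue measure. -/
theorem lintegral_translate_sub_le {f : V → ℝ} (hf : ContDiff ℝ 1 f) (v : V) :
    ∫⁻ z, ENNReal.ofReal |f (z + v) - f z| ≤ ∫⁻ z, ENNReal.ofReal |fderiv ℝ f z v| := by
  have hdc : Continuous fun z => fderiv ℝ f z v :=
    (hf.continuous_fderiv one_ne_zero).clm_apply continuous_const
  have hftc : ∀ z, f (z + v) - f z = ∫ s in (0 : ℝ)..1, fderiv ℝ f (z + s • v) v := by
    intro z
    have hd : ∀ s ∈ Set.uIcc (0 : ℝ) 1,
        HasDerivAt (fun s : ℝ => f (z + s • v)) (fderiv ℝ f (z + s • v) v) s := by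
      intro s _
      have h1 : HasDerivAt (fun s : ℝ => z + s • v) v s := by
        simpa using ((hasDerivAt_id s).smul_const v).const_add z
      exact ((hf.differentiable one_ne_zero).differentiableAt.hasFDerivAt).comp_hasDerivAt s h1
    rw [intervalIntegral.integral_eq_sub_of_hasDerivAt hd
      (Continuous.intervalIntegrable (by fun_prop) _ _)]
    simp
  calc ∫⁻ z, ENNReal.ofReal |f (z + v) - f z|
      ≤ ∫⁻ z, ∫⁻ s in Set.Ioc (0 : ℝ) 1, ENNReal.ofReal |fderiv ℝ f (z + s • v) v| := by
        refine lintegral_mono fun z => ?_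
        rw [hftc z, intervalIntegral.integral_of_le zero_le_one]
        simp_rw [← Real.norm_eq_abs, ofReal_norm]
        exact enorm_integral_le_lintegral_enorm _
    _ = ∫⁻ s in Set.Ioc (0 : ℝ) 1, ∫⁻ z, ENNReal.ofReal |fderiv ℝ f (z + s • v) v| := by
        refine lintegral_lintegral_swap (Continuous.aemeasurable ?_)
        change Continuous fun p : V × ℝ => ENNReal.ofReal |fderiv ℝ f (p.1 + p.2 • v) v|
        have : Continuous fun p : V × ℝ => |fderiv ℝ f (p.1 + p.2 • v) v| :=
          (hdc.comp (continuous_fst.add (continuous_snd.smul continuous_const))).abs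
        exact ENNReal.continuous_ofReal.comp this
    _ = ∫⁻ s in Set.Ioc (0 : ℝ) 1, ∫⁻ z, ENNReal.ofReal |fderiv ℝ f z v| := by
        refine lintegral_congr fun s => ?_
        exact lintegral_add_right_eq_self (fun z => ENNReal.ofReal |fderiv ℝ f z v|) (s • v)
    _ = ∫⁻ z, ENNReal.ofReal |fderiv ℝ f z v| := by simp

end Translation

/-! ### The symbol of a measure of small jumps -/

section SmallJumps

open scoped ContDiff

variable {V : Type*} [NormedAddCommGroup V] [InnerProductSpace ℝ V] [FiniteDimensional ℝ V]
  [MeasurableSpace V] [BorelSpace V]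

theorem norm_exp_I_mul_sub_one_le (u : ℝ) : ‖1 - Complex.exp (Complex.I * u)‖ ≤ |u| := by
  rw [norm_sub_rev]
  exact Real.norm_exp_I_mul_ofReal_sub_one_le

theorem norm_one_add_sub_exp_le (u : ℝ) :
    ‖1 + Complex.I * u - Complex.exp (Complex.I * u)‖ ≤ 3 * u ^ 2 := by
  rcases le_total |u| 1 with h | h
  · have h1 := Complex.norm_exp_sub_one_sub_id_le (x := Complex.I * u) (by simpa using h)
    have h2 : ‖1 + Complex.I * u - Complex.exp (Complex.I * u)‖
        = ‖Complex.exp (Complex.I * u) - 1 - Complex.I * u‖ := by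
      rw [← norm_neg]
      congr 1
      ring
    rw [h2]
    refine h1.trans ?_
    simp only [norm_mul, Complex.norm_I, one_mul, Complex.norm_real, Real.norm_eq_abs, sq_abs]
    nlinarith [sq_nonneg u]
  · have h1 : ‖1 + Complex.I * u - Complex.exp (Complex.I * u)‖ ≤ |u| + |u| := by
      calc ‖1 + Complex.I * u - Complex.exp (Complex.I * u)‖
          = ‖Complex.I * u + (1 - Complex.exp (Complex.I * u))‖ := by congr 1; ring
        _ ≤ ‖Complex.I * u‖ + ‖1 - Complex.exp (Complex.I * u)‖ := norm_add_le _ _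
        _ ≤ |u| + |u| := add_le_add (by simp) (norm_exp_I_mul_sub_one_le u)
    nlinarith [sq_abs u]

/-- The linear form `v ↦ z · v`, with complex values. -/
noncomputable def innerC (z : V) : V →L[ℝ] ℂ := Complex.ofRealCLM.comp (innerSL ℝ z)

omit [FiniteDimensional ℝ V] [MeasurableSpace V] [BorelSpace V] in
theorem innerC_apply (z v : V) : innerC z v = (⟪z, v⟫ : ℂ) := rfl
omit [FiniteDimensional ℝ V] [MeasurableSpace V] [BorelSpace V] in
theorem norm_innerC_le (z : V) : ‖innerC z‖ ≤ ‖z‖ := by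
  refine ContinuousLinearMap.opNorm_le_bound _ (norm_nonneg _) fun v => ?_
  rw [innerC_apply, Complex.norm_real]
  exact norm_inner_le_norm z v

omit [FiniteDimensional ℝ V] [MeasurableSpace V] [BorelSpace V] in
theorem continuous_innerC : Continuous (innerC : V → V →L[ℝ] ℂ) :=
  (Complex.ofRealCLM.postcomp V).continuous.comp (innerSL ℝ).continuous

/-- The bilinear form `z ⊗ z`, with complex values. -/
noncomputable def innerSqC (z : V) : V →L[ℝ] V →L[ℝ] ℂ := (innerSL ℝ z).smulRight (innerC z)

omit [FiniteDimensional ℝ V] [MeasurableSpace V] [BorelSpace V] in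
theorem norm_innerSqC_le (z : V) : ‖innerSqC z‖ ≤ ‖z‖ ^ 2 := by
  rw [innerSqC, ContinuousLinearMap.norm_smulRight_apply, innerSL_apply_norm, sq]
  exact mul_le_mul_of_nonneg_left (norm_innerC_le z) (norm_nonneg z)

omit [FiniteDimensional ℝ V] [MeasurableSpace V] [BorelSpace V] in
theorem continuous_innerSqC : Continuous (innerSqC : V → V →L[ℝ] V →L[ℝ] ℂ) :=
  ((ContinuousLinearMap.smulRightL ℝ V (V →L[ℝ] ℂ)).continuous.comp
    (innerSL ℝ).continuous).clm_apply continuous_innerC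

omit [FiniteDimensional ℝ V] [MeasurableSpace V] [BorelSpace V] in
theorem hasFDerivAt_exp_I_inner (z ξ : V) :
    HasFDerivAt (fun ξ : V => Complex.exp (Complex.I * (⟪ξ, z⟫ : ℂ)))
      ((Complex.exp (Complex.I * (⟪ξ, z⟫ : ℂ)) * Complex.I) • innerC z) ξ := by
  have h : HasFDerivAt (fun ξ : V => (⟪ξ, z⟫ : ℂ)) (innerC z) ξ := by
    have : (fun ξ : V => (⟪ξ, z⟫ : ℂ)) = innerC z := by
      ext v
      rw [innerC_apply, real_inner_comm]
    rw [this]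
    exact (innerC z).hasFDerivAt
  simpa [smul_smul] using (h.const_mul Complex.I).cexp

/-- Measures of jumps of size at most one, with a bound on the second moment and on the decay of
`exp (-symbol N)`. -/
structure IsSmallJump (N : Measure V) (K : ℝ) (D : ℕ → ℝ) : Prop where
  norm_le_one : ∀ᵐ z ∂N, ‖z‖ ≤ 1
  integrable_sq : Integrable (fun z => ‖z‖ ^ 2) N
  integral_sq_le : ∫ z, ‖z‖ ^ 2 ∂N ≤ K
  decay : ∀ (p : ℕ) (ξ : V), (1 + ‖ξ‖) ^ p * Real.exp (-(symbol N ξ).re) ≤ D p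

variable {N : Measure V} {K : ℝ} {D : ℕ → ℝ}

omit [FiniteDimensional ℝ V] [BorelSpace V] in
theorem symbol_eq_of_norm_le_one (h1 : ∀ᵐ z ∂N, ‖z‖ ≤ 1) (ξ : V) :
    symbol N ξ
      = ∫ z, (1 + Complex.I * (⟪ξ, z⟫ : ℂ) - Complex.exp (Complex.I * (⟪ξ, z⟫ : ℂ))) ∂N := by
  refine integral_congr_ae ?_
  filter_upwards [h1] with z hz
  simp [hz]

omit [FiniteDimensional ℝ V] in
theorem integrable_one_add_sub_exp (h2 : Integrable (fun z => ‖z‖ ^ 2) N) (ξ : V) :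
    Integrable (fun z =>
      1 + Complex.I * (⟪ξ, z⟫ : ℂ) - Complex.exp (Complex.I * (⟪ξ, z⟫ : ℂ))) N := by
  refine (h2.const_mul (3 * ‖ξ‖ ^ 2)).mono' (Continuous.aestronglyMeasurable (by fun_prop))
    (Filter.Eventually.of_forall fun z => ?_)
  refine (norm_one_add_sub_exp_le ⟪ξ, z⟫).trans ?_
  have h := abs_real_inner_le_norm ξ z
  have h' : ⟪ξ, z⟫ ^ 2 ≤ (‖ξ‖ * ‖z‖) ^ 2 := by
    rw [← sq_abs]
    exact pow_le_pow_left₀ (abs_nonneg _) h 2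
  nlinarith

omit [FiniteDimensional ℝ V] [MeasurableSpace V] [BorelSpace V] in
theorem norm_symbol_fderiv_le (ξ z : V) :
    ‖(Complex.I * (1 - Complex.exp (Complex.I * (⟪ξ, z⟫ : ℂ)))) • innerC z‖
      ≤ ‖ξ‖ * ‖z‖ ^ 2 := by
  rw [norm_smul, norm_mul, Complex.norm_I, one_mul]
  calc ‖1 - Complex.exp (Complex.I * (⟪ξ, z⟫ : ℂ))‖ * ‖innerC z‖
      ≤ (‖ξ‖ * ‖z‖) * ‖z‖ := by
        gcongr
        · exact (norm_exp_I_mul_sub_one_le _).trans (abs_real_inner_le_norm ξ z)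
        · exact norm_innerC_le z
    _ = ‖ξ‖ * ‖z‖ ^ 2 := by ring

theorem integrable_symbol_fderiv (h2 : Integrable (fun z => ‖z‖ ^ 2) N) (ξ : V) :
    Integrable (fun z =>
      (Complex.I * (1 - Complex.exp (Complex.I * (⟪ξ, z⟫ : ℂ)))) • innerC z) N := by
  refine (h2.const_mul ‖ξ‖).mono' (Continuous.aestronglyMeasurable ?_)
    (Filter.Eventually.of_forall fun z => norm_symbol_fderiv_le ξ z)
  have hc : Continuous fun z : V =>
      Complex.I * (1 - Complex.exp (Complex.I * (⟪ξ, z⟫ : ℂ))) := by fun_prop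
  exact hc.smul continuous_innerC

/-- Differentiation under the integral; `|z|` alone is not integrable, but the factor
`1 - exp (i ξ · z)` supplies the second power. -/
theorem hasFDerivAt_symbol (h1 : ∀ᵐ z ∂N, ‖z‖ ≤ 1) (h2 : Integrable (fun z => ‖z‖ ^ 2) N)
    (ξ : V) :
    HasFDerivAt (symbol N)
      (∫ z, (Complex.I * (1 - Complex.exp (Complex.I * (⟪ξ, z⟫ : ℂ)))) • innerC z ∂N) ξ := by
  rw [show symbol N = _ from funext (symbol_eq_of_norm_le_one h1)]
  refine hasFDerivAt_integral_of_dominated_of_fderiv_le (s := Metric.ball ξ 1)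
    (bound := fun z => (‖ξ‖ + 1) * ‖z‖ ^ 2) (F' := fun ξ z =>
      (Complex.I * (1 - Complex.exp (Complex.I * (⟪ξ, z⟫ : ℂ)))) • innerC z)
    (Metric.ball_mem_nhds ξ one_pos) ?_ ?_ ?_ ?_ ?_ ?_
  · exact Filter.Eventually.of_forall fun x => (integrable_one_add_sub_exp h2 x).1
  · exact integrable_one_add_sub_exp h2 ξ
  · exact (integrable_symbol_fderiv h2 ξ).1
  · refine Filter.Eventually.of_forall fun z x hx => (norm_symbol_fderiv_le x z).trans ?_
    have hx' : ‖x‖ ≤ ‖ξ‖ + 1 := by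
      have := norm_sub_norm_le x ξ
      have := mem_ball_iff_norm.mp hx
      linarith
    gcongr
  · exact h2.const_mul _
  · refine Filter.Eventually.of_forall fun z x _ => ?_
    have h3 : HasFDerivAt (fun ξ : V => (⟪ξ, z⟫ : ℂ)) (innerC z) x := by
      have : (fun ξ : V => (⟪ξ, z⟫ : ℂ)) = innerC z := by
        ext v
        rw [innerC_apply, real_inner_comm]
      rw [this]
      exact (innerC z).hasFDerivAt
    have h4 := ((h3.const_mul Complex.I).const_add 1).sub (hasFDerivAt_exp_I_inner z x)
    convert! h4 using 1
    ext v
    simp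
    ring

omit [FiniteDimensional ℝ V] [MeasurableSpace V] [BorelSpace V] in
theorem norm_exp_smul_le_sq {E : Type*} [NormedAddCommGroup E] [NormedSpace ℂ E] {q : V → E}
    (hq : ∀ z, ‖q z‖ ≤ ‖z‖ ^ 2) (ξ z : V) :
    ‖Complex.exp (Complex.I * (⟪ξ, z⟫ : ℂ)) • q z‖ ≤ ‖z‖ ^ 2 := by
  rw [norm_smul, Complex.norm_exp_I_mul_ofReal, one_mul]
  exact hq z

/-- After two derivatives the integrand is dominated by `|z|²`, so that no cancellation is needed
from here on. -/
theorem hasFDerivAt_symbol_fderiv (h2 : Integrable (fun z => ‖z‖ ^ 2) N) (ξ : V) :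
    HasFDerivAt (fun ξ =>
        ∫ z, (Complex.I * (1 - Complex.exp (Complex.I * (⟪ξ, z⟫ : ℂ)))) • innerC z ∂N)
      (∫ z, Complex.exp (Complex.I * (⟪ξ, z⟫ : ℂ)) • innerSqC z ∂N) ξ := by
  refine hasFDerivAt_integral_of_dominated_of_fderiv_le (s := Set.univ)
    (bound := fun z => ‖z‖ ^ 2) (F' := fun ξ z =>
      Complex.exp (Complex.I * (⟪ξ, z⟫ : ℂ)) • innerSqC z)
    Filter.univ_mem ?_ ?_ ?_ ?_ h2 ?_
  · exact Filter.Eventually.of_forall fun x => (integrable_symbol_fderiv h2 x).1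
  · exact integrable_symbol_fderiv h2 ξ
  · have hc : Continuous fun z : V => Complex.exp (Complex.I * (⟪ξ, z⟫ : ℂ)) := by fun_prop
    exact hc.aestronglyMeasurable.smul continuous_innerSqC.aestronglyMeasurable
  · exact Filter.Eventually.of_forall fun z x _ =>
      norm_exp_smul_le_sq (E := V →L[ℝ] V →L[ℝ] ℂ) (q := innerSqC) norm_innerSqC_le x z
  · refine Filter.Eventually.of_forall fun z x _ => ?_
    have h4 := (((hasFDerivAt_exp_I_inner z x).const_sub 1).const_mul Complex.I).smul_const
      (innerC z)
    convert! h4 using 1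
    ext v w
    simp [innerSqC, innerC_apply]
    ring_nf
    simp

section FourierIntegral

variable {E : Type*} [NormedAddCommGroup E] [NormedSpace ℂ E] {q : V → E}

/-- The pairing `(z, ξ) ↦ -(z · ξ) / 2π`, which turns the Fourier integrals of Mathlib into
integrals of `exp (i ξ · z)`. -/
noncomputable def negInnerDivTwoPi : V →L[ℝ] V →L[ℝ] ℝ := (-(2 * Real.pi)⁻¹) • innerSL ℝ

omit [FiniteDimensional ℝ V] [MeasurableSpace V] [BorelSpace V] in
theorem negInnerDivTwoPi_apply (z ξ : V) :
    negInnerDivTwoPi z ξ = -(2 * Real.pi)⁻¹ * ⟪z, ξ⟫ := rfl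

omit [FiniteDimensional ℝ V] [MeasurableSpace V] [BorelSpace V] in
theorem two_pi_mul_norm_negInnerDivTwoPi_le :
    2 * Real.pi * ‖(negInnerDivTwoPi : V →L[ℝ] V →L[ℝ] ℝ)‖ ≤ 1 := by
  have h3 : ‖(negInnerDivTwoPi : V →L[ℝ] V →L[ℝ] ℝ)‖ ≤ (2 * Real.pi)⁻¹ := by
    refine ContinuousLinearMap.opNorm_le_bound₂ _ (by positivity) fun z ξ => ?_
    rw [negInnerDivTwoPi_apply, norm_mul, norm_neg, Real.norm_of_nonneg (by positivity), mul_assoc]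
    gcongr
    exact norm_inner_le_norm z ξ
  calc 2 * Real.pi * ‖(negInnerDivTwoPi : V →L[ℝ] V →L[ℝ] ℝ)‖
      ≤ 2 * Real.pi * (2 * Real.pi)⁻¹ := by gcongr
    _ = 1 := mul_inv_cancel₀ (by positivity)

omit [FiniteDimensional ℝ V] [BorelSpace V] in
theorem integral_exp_smul_eq_fourierIntegral (N : Measure V) (q : V → E) :
    (fun ξ : V => ∫ z, Complex.exp (Complex.I * (⟪ξ, z⟫ : ℂ)) • q z ∂N)
      = VectorFourier.fourierIntegral Real.fourierChar N negInnerDivTwoPi.toLinearMap₁₂ q := by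
  ext1 ξ
  rw [VectorFourier.fourierIntegral]
  refine integral_congr_ae (Filter.Eventually.of_forall fun z => ?_)
  simp only [Circle.smul_def, Real.fourierChar_apply]
  congr 2
  change _ = ((2 * Real.pi * -(negInnerDivTwoPi z ξ) : ℝ) : ℂ) * Complex.I
  rw [negInnerDivTwoPi_apply, real_inner_comm, mul_comm Complex.I]
  congr 2
  field_simp

omit [InnerProductSpace ℝ V] [FiniteDimensional ℝ V] [NormedSpace ℂ E] in
theorem integrable_pow_mul_norm (hqc : AEStronglyMeasurable q N) (hq : ∀ z, ‖q z‖ ≤ ‖z‖ ^ 2)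
    (h1 : ∀ᵐ z ∂N, ‖z‖ ≤ 1) (h2 : Integrable (fun z => ‖z‖ ^ 2) N) (n : ℕ) :
    Integrable (fun z => ‖z‖ ^ n * ‖q z‖) N := by
  refine h2.mono' ((continuous_norm.pow n).aestronglyMeasurable.mul hqc.norm) ?_
  filter_upwards [h1] with z hz
  rw [Real.norm_of_nonneg (by positivity)]
  calc ‖z‖ ^ n * ‖q z‖ ≤ 1 * ‖z‖ ^ 2 := by
        gcongr
        · exact pow_le_one₀ (norm_nonneg _) hz
        · exact hq z
    _ = ‖z‖ ^ 2 := one_mul _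

theorem norm_iteratedFDeriv_integral_exp_smul_le (hqc : AEStronglyMeasurable q N)
    (hq : ∀ z, ‖q z‖ ≤ ‖z‖ ^ 2)
    (h1 : ∀ᵐ z ∂N, ‖z‖ ≤ 1) (h2 : Integrable (fun z => ‖z‖ ^ 2) N) (n : ℕ) (ξ : V) :
    ‖iteratedFDeriv ℝ n
      (fun ξ : V => ∫ z, Complex.exp (Complex.I * (⟪ξ, z⟫ : ℂ)) • q z ∂N) ξ‖
      ≤ ∫ z, ‖z‖ ^ 2 ∂N := by
  rw [integral_exp_smul_eq_fourierIntegral,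
    VectorFourier.iteratedFDeriv_fourierIntegral negInnerDivTwoPi (N := ⊤)
      (fun n _ => integrable_pow_mul_norm hqc hq h1 h2 n) hqc le_top]
  refine (VectorFourier.norm_fourierIntegral_le_integral_norm _ _ _ _ _).trans ?_
  refine integral_mono_of_nonneg (Filter.Eventually.of_forall fun z => norm_nonneg _) h2 ?_
  filter_upwards [h1] with z hz
  refine (VectorFourier.norm_fourierPowSMulRight_le negInnerDivTwoPi q z n).trans ?_
  calc (2 * Real.pi * ‖(negInnerDivTwoPi : V →L[ℝ] V →L[ℝ] ℝ)‖) ^ n * ‖z‖ ^ n * ‖q z‖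
      ≤ 1 * 1 * ‖z‖ ^ 2 := by
        gcongr
        · exact pow_le_one₀ (by positivity) two_pi_mul_norm_negInnerDivTwoPi_le
        · exact pow_le_one₀ (norm_nonneg _) hz
        · exact hq z
    _ = ‖z‖ ^ 2 := by ring

theorem contDiff_integral_exp_smul (hqc : AEStronglyMeasurable q N)
    (hq : ∀ z, ‖q z‖ ≤ ‖z‖ ^ 2)
    (h1 : ∀ᵐ z ∂N, ‖z‖ ≤ 1) (h2 : Integrable (fun z => ‖z‖ ^ 2) N) :
    ContDiff ℝ ∞ (fun ξ : V => ∫ z, Complex.exp (Complex.I * (⟪ξ, z⟫ : ℂ)) • q z ∂N) := by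
  rw [integral_exp_smul_eq_fourierIntegral]
  exact VectorFourier.contDiff_fourierIntegral _
    fun n _ => integrable_pow_mul_norm hqc hq h1 h2 n

end FourierIntegral

theorem aestronglyMeasurable_innerSqC (N : Measure V) :
    AEStronglyMeasurable (innerSqC : V → V →L[ℝ] V →L[ℝ] ℂ) N :=
  continuous_innerSqC.aestronglyMeasurable

theorem fderiv_symbol_eq (h1 : ∀ᵐ z ∂N, ‖z‖ ≤ 1) (h2 : Integrable (fun z => ‖z‖ ^ 2) N) :
    fderiv ℝ (symbol N) = fun ξ =>
      ∫ z, (Complex.I * (1 - Complex.exp (Complex.I * (⟪ξ, z⟫ : ℂ)))) • innerC z ∂N :=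
  funext fun ξ => (hasFDerivAt_symbol h1 h2 ξ).fderiv

theorem fderiv_fderiv_symbol_eq (h1 : ∀ᵐ z ∂N, ‖z‖ ≤ 1)
    (h2 : Integrable (fun z => ‖z‖ ^ 2) N) :
    fderiv ℝ (fderiv ℝ (symbol N)) = fun ξ =>
      ∫ z, Complex.exp (Complex.I * (⟪ξ, z⟫ : ℂ)) • innerSqC z ∂N := by
  rw [fderiv_symbol_eq h1 h2]
  exact funext fun ξ => (hasFDerivAt_symbol_fderiv h2 ξ).fderiv

theorem contDiff_symbol (h1 : ∀ᵐ z ∂N, ‖z‖ ≤ 1) (h2 : Integrable (fun z => ‖z‖ ^ 2) N) :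
    ContDiff ℝ ∞ (symbol N) := by
  rw [contDiff_infty_iff_fderiv]
  refine ⟨fun ξ => (hasFDerivAt_symbol h1 h2 ξ).differentiableAt, ?_⟩
  rw [contDiff_infty_iff_fderiv, fderiv_fderiv_symbol_eq h1 h2]
  refine ⟨?_, ?_⟩
  · rw [fderiv_symbol_eq h1 h2]
    exact fun ξ => (hasFDerivAt_symbol_fderiv h2 ξ).differentiableAt
  · exact contDiff_integral_exp_smul (aestronglyMeasurable_innerSqC N) norm_innerSqC_le h1 h2

/-- The symbol of small jumps grows at most quadratically, with bounded derivatives of order at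
least two. The bound is in the geometric form required by the estimate for derivatives of
compositions. -/
theorem norm_iteratedFDeriv_symbol_le (h1 : ∀ᵐ z ∂N, ‖z‖ ≤ 1)
    (h2 : Integrable (fun z => ‖z‖ ^ 2) N) (h3 : ∫ z, ‖z‖ ^ 2 ∂N ≤ K) {i : ℕ} (hi : 1 ≤ i)
    (ξ : V) :
    ‖iteratedFDeriv ℝ i (symbol N) ξ‖ ≤ ((1 + K) * (1 + ‖ξ‖)) ^ i := by
  have hK : 0 ≤ K := (integral_nonneg fun z => by positivity).trans h3
  have hbase : 1 ≤ (1 + K) * (1 + ‖ξ‖) := by nlinarith [norm_nonneg ξ]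
  have hle : K + K * ‖ξ‖ ≤ ((1 + K) * (1 + ‖ξ‖)) ^ i :=
    le_trans (by nlinarith [norm_nonneg ξ]) (le_self_pow₀ hbase (by omega))
  refine le_trans ?_ hle
  match i, hi with
  | 1, _ =>
    rw [← norm_iteratedFDeriv_fderiv, norm_iteratedFDeriv_zero, fderiv_symbol_eq h1 h2]
    calc ‖∫ z, (Complex.I * (1 - Complex.exp (Complex.I * (⟪ξ, z⟫ : ℂ)))) • innerC z ∂N‖
        ≤ ∫ z, ‖ξ‖ * ‖z‖ ^ 2 ∂N :=
          norm_integral_le_of_norm_le (h2.const_mul _)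
            (Filter.Eventually.of_forall fun z => norm_symbol_fderiv_le ξ z)
      _ = (∫ z, ‖z‖ ^ 2 ∂N) * ‖ξ‖ := by rw [integral_const_mul, mul_comm]
      _ ≤ K + K * ‖ξ‖ := by nlinarith [norm_nonneg ξ]
  | n + 2, _ =>
    rw [← norm_iteratedFDeriv_fderiv, ← norm_iteratedFDeriv_fderiv, fderiv_fderiv_symbol_eq h1 h2]
    refine (norm_iteratedFDeriv_integral_exp_smul_le (aestronglyMeasurable_innerSqC N)
      norm_innerSqC_le h1 h2 n ξ).trans ?_
    nlinarith [norm_nonneg ξ]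

/-- By translation, the `n`-th real derivative of `exp` at `w` is `exp w` times the one at zero. -/
theorem norm_iteratedFDeriv_cexp (n : ℕ) (w : ℂ) :
    ‖iteratedFDeriv ℝ n Complex.exp w‖
      = ‖Complex.exp w‖ * ‖iteratedFDeriv ℝ n Complex.exp 0‖ := by
  have h1 : (fun v : ℂ => Complex.exp (w + v)) = Complex.exp w • Complex.exp := by
    ext v
    simp [Complex.exp_add]
  have h2 := iteratedFDeriv_comp_add_left (𝕜 := ℝ) (f := Complex.exp) n w 0
  have h3 : ContDiff ℝ n Complex.exp := Complex.contDiff_exp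
  rw [h1, add_zero, iteratedFDeriv_const_smul_apply h3.contDiffAt] at h2
  rw [← h2, norm_smul]

theorem norm_pow_mul_iteratedFDeriv_exp_symbol_le (h : IsSmallJump N K D) (k n : ℕ) (ξ : V) :
    ‖ξ‖ ^ k * ‖iteratedFDeriv ℝ n (fun ξ => Complex.exp (-symbol N ξ)) ξ‖
      ≤ n.factorial * (∑ i ∈ Finset.range (n + 1), ‖iteratedFDeriv ℝ i Complex.exp 0‖)
        * (1 + K) ^ n * D (k + n) := by
  have hK : 0 ≤ K := (integral_nonneg fun z => by positivity).trans h.integral_sq_le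
  set S := ∑ i ∈ Finset.range (n + 1), ‖iteratedFDeriv ℝ i Complex.exp (0 : ℂ)‖ with hS
  have hcd := contDiff_symbol h.norm_le_one h.integrable_sq
  have hmain := norm_iteratedFDeriv_comp_le (𝕜 := ℝ) (g := Complex.exp)
    (f := fun ξ => -symbol N ξ) (n := n) (N := ∞) Complex.contDiff_exp hcd.neg
    (by exact_mod_cast le_top) ξ
    (C := ‖Complex.exp (-symbol N ξ)‖ * S) (D := (1 + K) * (1 + ‖ξ‖))
    (fun i hi => by
      rw [norm_iteratedFDeriv_cexp]
      refine mul_le_mul_of_nonneg_left ?_ (norm_nonneg _)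
      exact Finset.single_le_sum (f := fun i => ‖iteratedFDeriv ℝ i Complex.exp (0 : ℂ)‖)
        (fun _ _ => norm_nonneg _) (Finset.mem_range.mpr (by omega)))
    (fun i hi _ => by
      rw [show (fun ξ => -symbol N ξ) = -symbol N from rfl, iteratedFDeriv_neg, Pi.neg_apply,
        norm_neg]
      exact norm_iteratedFDeriv_symbol_le h.norm_le_one h.integrable_sq h.integral_sq_le hi ξ)
  have hS0 : 0 ≤ S := Finset.sum_nonneg fun _ _ => norm_nonneg _
  have hd := h.decay (k + n) ξ
  rw [Complex.norm_exp, Complex.neg_re] at hmain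
  calc ‖ξ‖ ^ k * ‖iteratedFDeriv ℝ n (fun ξ => Complex.exp (-symbol N ξ)) ξ‖
      ≤ (1 + ‖ξ‖) ^ k * (n.factorial * (Real.exp (-(symbol N ξ).re) * S)
        * ((1 + K) * (1 + ‖ξ‖)) ^ n) := by
        gcongr
        · linarith
        · exact hmain
    _ = n.factorial * S * (1 + K) ^ n * ((1 + ‖ξ‖) ^ (k + n) * Real.exp (-(symbol N ξ).re)) := by
        rw [mul_pow, pow_add]
        ring
    _ ≤ n.factorial * S * (1 + K) ^ n * D (k + n) := by gcongr

/-- The function `exp (-symbol N)` as a Schwartz function. -/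
noncomputable def expSymbol (h : IsSmallJump N K D) : 𝓢(V, ℂ) where
  toFun ξ := Complex.exp (-symbol N ξ)
  smooth' := Complex.contDiff_exp.comp (contDiff_symbol h.norm_le_one h.integrable_sq).neg
  decay' k n := ⟨_, norm_pow_mul_iteratedFDeriv_exp_symbol_le h k n⟩

theorem expSymbol_apply (h : IsSmallJump N K D) (ξ : V) :
    expSymbol h ξ = Complex.exp (-symbol N ξ) := rfl

open LineDeriv in
/-- The functions `exp (-symbol N)`, for `N` with fixed bounds, form a bounded set of the Schwartz
space, and `φ ↦ ∂_v (𝓕 φ)` is continuous from there to `L¹`. -/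
theorem exists_integral_lineDeriv_fourier_expSymbol_le (K : ℝ) (D : ℕ → ℝ) (v : V) :
    ∃ M : ℝ, ∀ (N : Measure V) (h : IsSmallJump N K D),
      ∫ x, ‖(∂_{v} (𝓕 (expSymbol h)) : 𝓢(V, ℂ)) x‖ ≤ M := by
  set T : 𝓢(V, ℂ) →L[ℝ] Lp ℂ 1 (volume : Measure V) :=
    (SchwartzMap.toLpCLM ℝ ℂ 1 volume).comp
      ((lineDerivOpCLM ℝ 𝓢(V, ℂ) v).comp (SchwartzMap.fourierTransformCLM ℝ)) with hT
  set S : Set 𝓢(V, ℂ) := {φ | ∃ (N : Measure V) (h : IsSmallJump N K D), φ = expSymbol h}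
  have hS : Bornology.IsVonNBounded ℝ S := by
    rw [(schwartz_withSeminorms ℝ V ℂ).isVonNBounded_iff_seminorm_bddAbove]
    intro i
    refine ⟨max 0 (i.2.factorial *
        (∑ j ∈ Finset.range (i.2 + 1), ‖iteratedFDeriv ℝ j Complex.exp 0‖)
        * (1 + K) ^ i.2 * D (i.1 + i.2)), ?_⟩
    rintro _ ⟨φ, ⟨N, h, rfl⟩, rfl⟩
    refine SchwartzMap.seminorm_le_bound ℝ i.1 i.2 _ (le_max_left _ _) fun x => ?_
    exact (norm_pow_mul_iteratedFDeriv_exp_symbol_le h i.1 i.2 x).trans (le_max_right _ _)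
  have hTS := hS.image T
  rw [NormedSpace.isVonNBounded_iff, isBounded_iff_forall_norm_le] at hTS
  obtain ⟨M, hM⟩ := hTS
  refine ⟨M, fun N h => ?_⟩
  have := hM _ ⟨expSymbol h, ⟨N, h, rfl⟩, rfl⟩
  rw [← SchwartzMap.norm_toLp_one]
  exact this

end SmallJumps

/-! ### Densities whose characteristic function has a Schwartz factor -/

section SmoothDensity

open scoped ContDiff

variable {V : Type*} [NormedAddCommGroup V] [InnerProductSpace ℝ V] [FiniteDimensional ℝ V]
  [MeasurableSpace V] [BorelSpace V]

theorem fourier_const_mul (c : ℂ) (φ : V → ℂ) (x : V) :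
    𝓕 (fun η => c * φ η) x = c * 𝓕 φ x := by
  simp_rw [Real.fourier_eq', smul_eq_mul]
  rw [← integral_const_mul]
  congr 1
  ext η
  ring

theorem fderiv_fourier_apply {φ : V → ℂ} (h1 : Integrable φ)
    (h2 : Integrable fun η => ‖η‖ * ‖φ η‖) (v x : V) :
    fderiv ℝ (𝓕 φ) x v = 𝓕 (fun η => -(2 * Real.pi * Complex.I) * (⟪η, v⟫ : ℂ) * φ η) x := by
  rw [(Real.hasFDerivAt_fourier h1 h2 x).fderiv, Real.fourier_eq, Real.fourier_eq]
  have h3 : Integrable (VectorFourier.fourierSMulRight (innerSL ℝ) φ) := by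
    refine (h2.const_mul (2 * Real.pi * ‖(innerSL ℝ : V →L[ℝ] V →L[ℝ] ℝ)‖)).mono'
      h1.1.fourierSMulRight (Filter.Eventually.of_forall fun η => ?_)
    refine (VectorFourier.norm_fourierSMulRight_le _ _ _).trans (le_of_eq ?_)
    ring
  rw [ContinuousLinearMap.integral_apply ((Real.fourierIntegral_convergent_iff x).mpr h3)]
  refine integral_congr_ae (Filter.Eventually.of_forall fun η => ?_)
  simp [Circle.smul_def, mul_assoc]
  exact Or.inl rfl

open LineDeriv in
/-- If, up to a symmetric linear change of variables `A`, the characteristic function of `μ` is a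
Schwartz function `φ` times the characteristic function of a probability measure, then `μ` has a
smooth density, and the `L¹` norm of its derivative in the direction of an eigenvector of `A` is
controlled by that of `𝓕 φ`. -/
theorem smooth_density_of_charFun_eq_mul (μ ρ : Measure V) [IsProbabilityMeasure μ]
    [IsProbabilityMeasure ρ] (φ : 𝓢(V, ℂ)) (A : V ≃L[ℝ] V) (hA : ∀ v w, ⟪A v, w⟫ = ⟪v, A w⟫)
    (hμ : ∀ η, charFun μ ((2 * Real.pi) • η) = charFun ρ ((2 * Real.pi) • η) * φ (A η))
    {f : V → ℝ} (hf : ∀ x, f x = (𝓕 (fun η => charFun μ ((2 * Real.pi) • η)) x).re) :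
    (∀ x, 0 ≤ f x) ∧ μ = (volume.withDensity fun x => ENNReal.ofReal (f x)) ∧
      ContDiff ℝ ∞ f ∧ ∀ (v : V) (c : ℝ), 0 < c → A v = c • v →
        Integrable (fun z => fderiv ℝ f z v) ∧
          ∫ z, |fderiv ℝ f z v| ≤ c⁻¹ * ∫ x, ‖(∂_{v} (𝓕 φ) : 𝓢(V, ℂ)) x‖ := by
  set Φ : V → ℂ := fun η => charFun μ ((2 * Real.pi) • η) with hΦ
  set ψ : 𝓢(V, ℂ) := SchwartzMap.compCLMOfContinuousLinearEquiv ℝ A φ with hψ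
  have hψa : ∀ η, ψ η = φ (A η) := fun η => rfl
  have hΦψ : Φ = fun η => charFun ρ ((2 * Real.pi) • η) * ψ η := funext hμ
  have hΦc : Continuous Φ := continuous_charFun.comp (continuous_const_smul _)
  have hΦle : ∀ η, ‖Φ η‖ ≤ ‖ψ η‖ := fun η => by
    rw [hΦψ, norm_mul]
    exact mul_le_of_le_one_left (norm_nonneg _) (norm_charFun_le_one _)
  have hmom : ∀ n : ℕ, Integrable fun η => ‖η‖ ^ n * ‖Φ η‖ := fun n => by
    refine (ψ.integrable_pow_mul volume n).mono' (by fun_prop)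
      (Filter.Eventually.of_forall fun η => ?_)
    rw [Real.norm_of_nonneg (by positivity)]
    exact mul_le_mul_of_nonneg_left (hΦle η) (by positivity)
  have hΦi : Integrable Φ := by
    refine ψ.integrable.mono hΦc.aestronglyMeasurable (Filter.Eventually.of_forall hΦle)
  have hFi : Integrable (𝓕 Φ) := by
    rw [hΦψ]
    exact (integrable_fourier_charFun_mul ρ ψ.integrable (𝓕 ψ).integrable).1
  have hfF : f = fun x => (𝓕 Φ x).re := funext hf
  obtain ⟨hpos, hdens⟩ := eq_withDensity_of_integrable_charFun μ (fun η => rfl) hΦi hFi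
  have hFs : ContDiff ℝ ∞ (𝓕 Φ) := Real.contDiff_fourier (N := ⊤) fun n _ => hmom n
  rw [hfF]
  refine ⟨hpos, hdens, Complex.reCLM.contDiff.comp hFs, fun v c hc hv => ?_⟩
  have hderiv : ∀ z, fderiv ℝ (fun x => (𝓕 Φ x).re) z v = (fderiv ℝ (𝓕 Φ) z v).re := by
    intro z
    have hd := (hFs.differentiable (by simp)).differentiableAt (x := z)
    exact DFunLike.congr_fun (Complex.reCLM.hasFDerivAt.comp z hd.hasFDerivAt).fderiv v
  -- the multiplier of the derivative in the scaled variables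
  set M : V → ℂ := fun η => -(2 * Real.pi * Complex.I) * (⟪η, v⟫ : ℂ) * φ η with hM
  have hFM : 𝓕 M = (∂_{v} (𝓕 φ) : 𝓢(V, ℂ)) := by
    ext x
    rw [SchwartzMap.lineDerivOp_apply_eq_fderiv, SchwartzMap.fourier_coe,
      fderiv_fourier_apply φ.integrable (by simpa using φ.integrable_pow_mul volume 1)]
  have hMAeq : ∀ η, M (A η) = c * (-(2 * Real.pi * Complex.I) * (⟪η, v⟫ : ℂ) * ψ η) := by
    intro η
    simp only [hM, hψa, hA, hv, inner_smul_right]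
    push_cast
    ring
  have hMA : Integrable fun η => M (A η) := by
    simp_rw [hMAeq]
    refine Integrable.const_mul ?_ _
    refine ((ψ.integrable_pow_mul volume 1).const_mul (2 * Real.pi * ‖v‖)).mono' ?_
      (Filter.Eventually.of_forall fun η => ?_)
    · exact Continuous.aestronglyMeasurable (by fun_prop)
    · simp only [norm_mul, norm_neg, Complex.norm_I, Complex.norm_real, Complex.norm_ofNat,
        Real.norm_of_nonneg Real.pi_pos.le, pow_one, mul_one]
      have := norm_inner_le_norm (𝕜 := ℝ) η v
      calc 2 * Real.pi * ‖⟪η, v⟫‖ * ‖ψ η‖ ≤ 2 * Real.pi * (‖η‖ * ‖v‖) * ‖ψ η‖ := by gcongr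
        _ = 2 * Real.pi * ‖v‖ * (‖η‖ * ‖ψ η‖) := by ring
  obtain ⟨hFMAi, hFMA⟩ := integrable_fourier_comp_symmetric A hA (φ := M)
    (by rw [hFM]; exact SchwartzMap.integrable _)
  obtain ⟨hi, hle⟩ := integrable_fourier_charFun_mul ρ hMA hFMAi
  have hdF : ∀ z, fderiv ℝ (𝓕 Φ) z v = (c : ℂ)⁻¹ *
      𝓕 (fun η => charFun ρ ((2 * Real.pi) • η) * M (A η)) z := by
    intro z
    rw [fderiv_fourier_apply hΦi (by simpa using hmom 1), ← fourier_const_mul]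
    refine congrArg (fun g : V → ℂ => 𝓕 g z) (funext fun η => ?_)
    rw [hMAeq, hΦψ]
    have : (c : ℂ) ≠ 0 := Complex.ofReal_ne_zero.mpr hc.ne'
    field_simp
  simp_rw [hderiv, hdF]
  refine ⟨(hi.const_mul _).re, ?_⟩
  calc ∫ z, |((c : ℂ)⁻¹ * 𝓕 (fun η => charFun ρ ((2 * Real.pi) • η) * M (A η)) z).re|
      ≤ ∫ z, c⁻¹ * ‖𝓕 (fun η => charFun ρ ((2 * Real.pi) • η) * M (A η)) z‖ := by
        refine integral_mono (hi.const_mul _).re.abs (hi.norm.const_mul _) fun z => ?_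
        refine (Complex.abs_re_le_norm _).trans (le_of_eq ?_)
        rw [norm_mul, norm_inv, Complex.norm_real, Real.norm_of_nonneg hc.le]
    _ = c⁻¹ * ∫ z, ‖𝓕 (fun η => charFun ρ ((2 * Real.pi) • η) * M (A η)) z‖ :=
        integral_const_mul _ _
    _ ≤ c⁻¹ * ∫ x, ‖(∂_{v} (𝓕 φ) : 𝓢(V, ℂ)) x‖ := by
        refine mul_le_mul_of_nonneg_left ?_ (inv_nonneg.mpr hc.le)
        rw [← hFM, ← hFMA]
        exact hle

end SmoothDensity

/-! ### Small and large jumps of a Lévy measure -/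

section LevyMeasure

variable {V : Type*} [NormedAddCommGroup V] [InnerProductSpace ℝ V] [FiniteDimensional ℝ V]
  [MeasurableSpace V] [BorelSpace V] {ν : Measure V}

omit [InnerProductSpace ℝ V] [FiniteDimensional ℝ V] in
theorem IsLevyMeasure.integrable_min (hν : IsLevyMeasure ν) :
    Integrable (fun z => min 1 (‖z‖ ^ 2)) ν := by
  refine ⟨Continuous.aestronglyMeasurable (by fun_prop), ?_⟩
  rw [hasFiniteIntegral_iff_ofReal (Filter.Eventually.of_forall fun z => by positivity)]
  exact hν.2

omit [InnerProductSpace ℝ V] [FiniteDimensional ℝ V] in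
theorem IsLevyMeasure.measure_norm_ge_lt_top (hν : IsLevyMeasure ν) {δ : ℝ} (hδ : 0 < δ) :
    ν {z | δ ≤ ‖z‖} < ⊤ := by
  refine (measure_mono ?_).trans_lt
    (hν.integrable_min.measure_ge_lt_top (ε := min 1 (δ ^ 2)) (by positivity))
  intro z hz
  exact min_le_min le_rfl (pow_le_pow_left₀ hδ.le hz 2)

omit [FiniteDimensional ℝ V] [MeasurableSpace V] [BorelSpace V] in
theorem norm_symbol_integrand_le (ξ z : V) :
    ‖1 + (if ‖z‖ ≤ 1 then Complex.I * (⟪ξ, z⟫ : ℂ) else 0)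
      - Complex.exp (Complex.I * (⟪ξ, z⟫ : ℂ))‖ ≤ (3 * ‖ξ‖ ^ 2 + 2) * min 1 (‖z‖ ^ 2) := by
  split_ifs with h
  · rw [min_eq_right (pow_le_one₀ (norm_nonneg z) h)]
    have h1 : ⟪ξ, z⟫ ^ 2 ≤ (‖ξ‖ * ‖z‖) ^ 2 := by
      rw [← sq_abs]
      exact pow_le_pow_left₀ (abs_nonneg _) (abs_real_inner_le_norm ξ z) 2
    nlinarith [norm_one_add_sub_exp_le ⟪ξ, z⟫, sq_nonneg ‖z‖]
  · rw [min_eq_left (one_le_pow₀ (not_le.mp h).le), add_zero, mul_one]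
    refine (norm_sub_le _ _).trans ?_
    rw [norm_one, Complex.norm_exp_I_mul_ofReal]
    nlinarith [sq_nonneg ‖ξ‖]

theorem IsLevyMeasure.integrable_symbol (hν : IsLevyMeasure ν) (ξ : V) :
    Integrable (fun z => 1 + (if ‖z‖ ≤ 1 then Complex.I * (⟪ξ, z⟫ : ℂ) else 0)
      - Complex.exp (Complex.I * (⟪ξ, z⟫ : ℂ))) ν := by
  refine (hν.integrable_min.const_mul _).mono' (Measurable.aestronglyMeasurable ?_)
    (Filter.Eventually.of_forall fun z => norm_symbol_integrand_le ξ z)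
  have h : MeasurableSet {z : V | ‖z‖ ≤ 1} := measurableSet_le measurable_norm measurable_const
  exact (measurable_const.add (Measurable.ite h (by fun_prop) measurable_const)).sub (by fun_prop)

omit [FiniteDimensional ℝ V] [MeasurableSpace V] [BorelSpace V] in
theorem re_symbol_integrand (ξ z : V) :
    (1 + (if ‖z‖ ≤ 1 then Complex.I * (⟪ξ, z⟫ : ℂ) else 0)
      - Complex.exp (Complex.I * (⟪ξ, z⟫ : ℂ))).re = 1 - Real.cos ⟪ξ, z⟫ := by
  have h : (Complex.exp (Complex.I * (⟪ξ, z⟫ : ℂ))).re = Real.cos ⟪ξ, z⟫ := by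
    rw [mul_comm, Complex.exp_ofReal_mul_I_re]
  rw [Complex.sub_re, h]
  split_ifs <;> simp

theorem IsLevyMeasure.integrable_one_sub_cos (hν : IsLevyMeasure ν) (ξ : V) :
    Integrable (fun z => 1 - Real.cos ⟪ξ, z⟫) ν := by
  have h := (hν.integrable_symbol ξ).re
  simpa only [RCLike.re_eq_complex_re, re_symbol_integrand] using! h

theorem IsLevyMeasure.re_symbol (hν : IsLevyMeasure ν) (ξ : V) :
    (symbol ν ξ).re = ∫ z, (1 - Real.cos ⟪ξ, z⟫) ∂ν := by
  have h := Complex.reCLM.integral_comp_comm (hν.integrable_symbol ξ)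
  simp only [Complex.reCLM_apply, re_symbol_integrand] at h
  exact h.symm

theorem IsLevyMeasure.re_symbol_nonneg (hν : IsLevyMeasure ν) (ξ : V) : 0 ≤ (symbol ν ξ).re := by
  rw [hν.re_symbol]
  exact integral_nonneg fun z => sub_nonneg.mpr (Real.cos_le_one _)

/-- The jumps `z` with `|S z| ≤ 1`, rescaled by `S` and with intensity `t`. -/
noncomputable def smallJumps (ν : Measure V) (t : ℝ) (S : V ≃L[ℝ] V) : Measure V :=
  ENNReal.ofReal t • (ν.restrict {z | ‖S z‖ ≤ 1}).map S

variable {t : ℝ} {S : V ≃L[ℝ] V}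

omit [FiniteDimensional ℝ V] in
theorem measurableSet_norm_le_one (S : V ≃L[ℝ] V) : MeasurableSet {z | ‖S z‖ ≤ 1} :=
  measurableSet_le S.continuous.norm.measurable measurable_const

omit [FiniteDimensional ℝ V] in
theorem smallJumps_norm_le_one (ν : Measure V) (t : ℝ) (S : V ≃L[ℝ] V) :
    ∀ᵐ z ∂(smallJumps ν t S), ‖z‖ ≤ 1 := by
  refine Measure.ae_smul_measure ?_ _
  rw [ae_map_iff S.continuous.measurable.aemeasurable
    (measurableSet_le measurable_norm measurable_const)]
  exact ae_restrict_mem (measurableSet_norm_le_one S)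

omit [FiniteDimensional ℝ V] in
theorem integral_smallJumps {E : Type*} [NormedAddCommGroup E] [NormedSpace ℝ E] (ht : 0 ≤ t)
    (S : V ≃L[ℝ] V) (g : V → E) :
    ∫ z, g z ∂(smallJumps ν t S) = t • ∫ z in {z | ‖S z‖ ≤ 1}, g (S z) ∂ν := by
  rw [smallJumps, integral_smul_measure, ENNReal.toReal_ofReal ht]
  congr 1
  exact integral_map_equiv S.toHomeomorph.toMeasurableEquiv g

omit [FiniteDimensional ℝ V] in
theorem IsLevyMeasure.integrableOn_norm_sq (hν : IsLevyMeasure ν) (S : V ≃L[ℝ] V) :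
    IntegrableOn (fun z => ‖S z‖ ^ 2) {z | ‖S z‖ ≤ 1} ν := by
  refine ((hν.integrable_min.const_mul (1 + ‖(S : V →L[ℝ] V)‖ ^ 2)).integrableOn).mono'
    (Continuous.aestronglyMeasurable (by fun_prop)) ?_
  filter_upwards [ae_restrict_mem (measurableSet_norm_le_one S)] with z hz
  have hz' : ‖S z‖ ≤ 1 := hz
  rw [Real.norm_of_nonneg (by positivity)]
  have h1 : ‖S z‖ ≤ ‖(S : V →L[ℝ] V)‖ * ‖z‖ := (S : V →L[ℝ] V).le_opNorm z
  have h2 : ‖S z‖ ^ 2 ≤ (‖(S : V →L[ℝ] V)‖ * ‖z‖) ^ 2 := pow_le_pow_left₀ (norm_nonneg _) h1 2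
  have h3 : ‖S z‖ ^ 2 ≤ 1 := pow_le_one₀ (norm_nonneg _) hz'
  rcases min_cases (1 : ℝ) (‖z‖ ^ 2) with ⟨h, _⟩ | ⟨h, _⟩ <;> rw [h] <;>
    nlinarith [sq_nonneg ‖(S : V →L[ℝ] V)‖, sq_nonneg ‖z‖]

omit [FiniteDimensional ℝ V] in
theorem IsLevyMeasure.integrable_smallJumps_sq (hν : IsLevyMeasure ν) (t : ℝ) (S : V ≃L[ℝ] V) :
    Integrable (fun z => ‖z‖ ^ 2) (smallJumps ν t S) := by
  refine Integrable.smul_measure ?_ ENNReal.ofReal_ne_top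
  exact (integrable_map_equiv S.toHomeomorph.toMeasurableEquiv _).mpr (hν.integrableOn_norm_sq S)

omit [FiniteDimensional ℝ V] in
theorem IsLevyMeasure.measure_compl_lt_top (hν : IsLevyMeasure ν) (S : V ≃L[ℝ] V) :
    ν {z | ‖S z‖ ≤ 1}ᶜ < ⊤ := by
  have hδ : 0 < (‖(S : V →L[ℝ] V)‖ + 1)⁻¹ := by positivity
  refine (measure_mono fun z hz => ?_).trans_lt (hν.measure_norm_ge_lt_top hδ)
  have hz' : 1 < ‖S z‖ := not_le.mp hz
  have h1 : ‖S z‖ ≤ ‖(S : V →L[ℝ] V)‖ * ‖z‖ := (S : V →L[ℝ] V).le_opNorm z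
  change (‖(S : V →L[ℝ] V)‖ + 1)⁻¹ ≤ ‖z‖
  rw [inv_le_iff_one_le_mul₀ (by positivity)]
  nlinarith [norm_nonneg z]

omit [FiniteDimensional ℝ V] in
/-- If the adjoint of `S` is `S` itself, the symbol of the rescaled small jumps is, up to a linear
change of variables, the small jump part of the symbol. -/
theorem symbol_smallJumps (ht : 0 ≤ t) (hS : ∀ v w, ⟪S v, w⟫ = ⟪v, S w⟫)
    (hS1 : ∀ z, ‖S z‖ ≤ 1 → ‖z‖ ≤ 1) (ξ : V) :
    symbol (smallJumps ν t S) (S.symm ξ) = t * ∫ z in {z | ‖S z‖ ≤ 1},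
      (1 + (if ‖z‖ ≤ 1 then Complex.I * (⟪ξ, z⟫ : ℂ) else 0)
        - Complex.exp (Complex.I * (⟪ξ, z⟫ : ℂ))) ∂ν := by
  rw [symbol, integral_smallJumps ht, Complex.real_smul]
  congr 1
  refine setIntegral_congr_fun (measurableSet_norm_le_one S) fun z hz => ?_
  have hz' : ‖S z‖ ≤ 1 := hz
  have h : ⟪S.symm ξ, S z⟫ = ⟪ξ, z⟫ := by
    rw [← hS, S.apply_symm_apply]
  simp only [hz', hS1 z hz', h, if_true]

/-- Discarding the large jumps lowers the real part of the symbol by at most twice their mass. -/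
theorem re_symbol_smallJumps_ge (hν : IsLevyMeasure ν) (ht : 0 ≤ t)
    (hS : ∀ v w, ⟪S v, w⟫ = ⟪v, S w⟫) (hS1 : ∀ z, ‖S z‖ ≤ 1 → ‖z‖ ≤ 1) (ξ : V) :
    t * (symbol ν (S ξ)).re - 2 * (t * ν.real {z | ‖S z‖ ≤ 1}ᶜ)
      ≤ (symbol (smallJumps ν t S) ξ).re := by
  have h1 := symbol_smallJumps (ν := ν) ht hS hS1 (S ξ)
  rw [S.symm_apply_apply] at h1
  have h2 := Complex.reCLM.integral_comp_comm
    (hν.integrable_symbol (S ξ)).integrableOn (μ := ν.restrict {z | ‖S z‖ ≤ 1})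
  simp only [Complex.reCLM_apply, re_symbol_integrand] at h2
  rw [h1, Complex.re_ofReal_mul, ← h2, hν.re_symbol,
    ← integral_add_compl (measurableSet_norm_le_one S) (hν.integrable_one_sub_cos (S ξ))]
  have h3 : ∫ z in {z | ‖S z‖ ≤ 1}ᶜ, (1 - Real.cos ⟪S ξ, z⟫) ∂ν
      ≤ 2 * ν.real {z | ‖S z‖ ≤ 1}ᶜ := by
    have : IsFiniteMeasure (ν.restrict {z | ‖S z‖ ≤ 1}ᶜ) :=
      ⟨by simpa using hν.measure_compl_lt_top S⟩
    calc ∫ z in {z | ‖S z‖ ≤ 1}ᶜ, (1 - Real.cos ⟪S ξ, z⟫) ∂ν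
        ≤ ∫ z in {z | ‖S z‖ ≤ 1}ᶜ, 2 ∂ν :=
          integral_mono (hν.integrable_one_sub_cos (S ξ)).integrableOn (integrable_const _)
            fun z => by linarith [Real.neg_one_le_cos ⟪S ξ, z⟫]
      _ = 2 * ν.real {z | ‖S z‖ ≤ 1}ᶜ := by simp [mul_comm]
  nlinarith

theorem isSmallJump_smallJumps (hν : IsLevyMeasure ν) (ht : 0 ≤ t)
    (hS : ∀ v w, ⟪S v, w⟫ = ⟪v, S w⟫) (hS1 : ∀ z, ‖S z‖ ≤ 1 → ‖z‖ ≤ 1) {K : ℝ} {D : ℕ → ℝ}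
    (hsq : t * ∫ z in {z | ‖S z‖ ≤ 1}, ‖S z‖ ^ 2 ∂ν ≤ K)
    (htail : t * ν.real {z | ‖S z‖ ≤ 1}ᶜ ≤ K)
    (hdecay : ∀ (p : ℕ) (ξ : V), (1 + ‖ξ‖) ^ p * Real.exp (-(t * (symbol ν (S ξ)).re)) ≤ D p) :
    IsSmallJump (smallJumps ν t S) K (fun p => Real.exp (2 * K) * D p) where
  norm_le_one := smallJumps_norm_le_one ν t S
  integrable_sq := hν.integrable_smallJumps_sq t S
  integral_sq_le := by
    rw [integral_smallJumps ht]
    exact hsq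
  decay p ξ := by
    have h := re_symbol_smallJumps_ge hν ht hS hS1 ξ
    calc (1 + ‖ξ‖) ^ p * Real.exp (-(symbol (smallJumps ν t S) ξ).re)
        ≤ (1 + ‖ξ‖) ^ p * Real.exp (2 * K + -(t * (symbol ν (S ξ)).re)) := by
          gcongr
          linarith
      _ = Real.exp (2 * K) * ((1 + ‖ξ‖) ^ p * Real.exp (-(t * (symbol ν (S ξ)).re))) := by
          rw [Real.exp_add]
          ring
      _ ≤ Real.exp (2 * K) * D p := by
          gcongr
          exact hdecay p ξ

/-- The Lévy–Itô decomposition on the level of characteristic functions: the large jumps, with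
`|S z| > 1`, contribute a compound Poisson law and a shift. -/
theorem exists_exp_symbol_eq_charFun_mul (hν : IsLevyMeasure ν) (ht : 0 ≤ t)
    (hS : ∀ v w, ⟪S v, w⟫ = ⟪v, S w⟫) (hS1 : ∀ z, ‖S z‖ ≤ 1 → ‖z‖ ≤ 1) :
    ∃ ρ : Measure V, IsProbabilityMeasure ρ ∧ ∀ ξ : V, Complex.exp (-(t : ℂ) * symbol ν ξ)
      = charFun ρ ξ * Complex.exp (-symbol (smallJumps ν t S) (S.symm ξ)) := by
  set B : Set V := {z | ‖S z‖ ≤ 1} with hB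
  have hBm : MeasurableSet B := measurableSet_norm_le_one S
  have hfin : IsFiniteMeasure (ν.restrict Bᶜ) := ⟨by simpa using hν.measure_compl_lt_top S⟩
  set lam : Measure V := ENNReal.ofReal t • ν.restrict Bᶜ with hlam
  have hfin' : IsFiniteMeasure lam := Measure.smul_finite _ ENNReal.ofReal_ne_top
  have h1m : MeasurableSet {z : V | ‖z‖ ≤ 1} := measurableSet_le measurable_norm measurable_const
  set b : V := ∫ z in Bᶜ, (if ‖z‖ ≤ 1 then z else 0) ∂ν with hb
  have hbi : Integrable (fun z : V => if ‖z‖ ≤ 1 then z else 0) (ν.restrict Bᶜ) := by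
    refine (integrable_const (1 : ℝ)).mono'
      (Measurable.ite h1m measurable_id measurable_const).aestronglyMeasurable
      (Filter.Eventually.of_forall fun z => ?_)
    split_ifs with h
    · exact h
    · simp
  refine ⟨(compoundPoisson lam).map (· + (-(t • b))),
    Measure.isProbabilityMeasure_map (by fun_prop), fun ξ => ?_⟩
  rw [charFun_map_add_const, charFun_compoundPoisson, ← Complex.exp_add, ← Complex.exp_add,
    symbol_smallJumps ht hS hS1]
  congr 1
  have hexp : Integrable (fun z : V => Complex.exp (Complex.I * (⟪ξ, z⟫ : ℂ))) (ν.restrict Bᶜ) :=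
    (integrable_const (1 : ℝ)).mono' (Continuous.aestronglyMeasurable (by fun_prop))
      (Filter.Eventually.of_forall fun z => (Complex.norm_exp_I_mul_ofReal _).le)
  have hin : (∫ z in Bᶜ, (if ‖z‖ ≤ 1 then Complex.I * (⟪ξ, z⟫ : ℂ) else 0) ∂ν)
      = Complex.I * (⟪ξ, b⟫ : ℂ) := by
    have h := (innerC ξ).integral_comp_comm hbi
    rw [innerC_apply] at h
    rw [← h, ← integral_const_mul]
    refine integral_congr_ae (Filter.Eventually.of_forall fun z => ?_)
    simp only [innerC_apply]
    split_ifs <;> simp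
  have hini : Integrable (fun z : V => if ‖z‖ ≤ 1 then Complex.I * (⟪ξ, z⟫ : ℂ) else 0)
      (ν.restrict Bᶜ) := by
    have h := ((innerC ξ).integrable_comp hbi).const_mul Complex.I
    refine h.congr (Filter.Eventually.of_forall fun z => ?_)
    simp only [innerC_apply]
    split_ifs <;> simp
  have hc : charFun lam ξ = t * ∫ z in Bᶜ, Complex.exp (Complex.I * (⟪ξ, z⟫ : ℂ)) ∂ν := by
    rw [charFun_apply, hlam, integral_smul_measure, ENNReal.toReal_ofReal ht, Complex.real_smul]
    simp_rw [mul_comm Complex.I, real_inner_comm]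
  have hl : (lam.real Set.univ : ℂ) = t * ∫ z in Bᶜ, (1 : ℂ) ∂ν := by
    rw [hlam, measureReal_ennreal_smul_apply, ENNReal.toReal_ofReal ht]
    simp
  have hsplit : (∫ z in Bᶜ, (1 + (if ‖z‖ ≤ 1 then Complex.I * (⟪ξ, z⟫ : ℂ) else 0)
        - Complex.exp (Complex.I * (⟪ξ, z⟫ : ℂ))) ∂ν)
      = (∫ z in Bᶜ, (1 : ℂ) ∂ν) + Complex.I * (⟪ξ, b⟫ : ℂ)
        - ∫ z in Bᶜ, Complex.exp (Complex.I * (⟪ξ, z⟫ : ℂ)) ∂ν := by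
    rw [← hin, ← integral_add (integrable_const _) hini]
    exact integral_sub ((integrable_const (1 : ℂ)).add hini) hexp
  rw [hc, hl, symbol, ← integral_add_compl hBm (hν.integrable_symbol ξ), hsplit, inner_neg_left,
    inner_smul_left, real_inner_comm ξ b]
  simp only [conj_trivial]
  push_cast
  ring

end LevyMeasure

/-! ### Moments, tails and decay under anisotropic scaling -/

section Anisotropic

variable {d : ℕ}

/-- The diagonal map with entries `w k`. -/
noncomputable def diagEquiv (w : Fin d → ℝ) (hw : ∀ k, w k ≠ 0) :
    EuclideanSpace ℝ (Fin d) ≃L[ℝ] EuclideanSpace ℝ (Fin d) :=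
  LinearEquiv.toContinuousLinearEquiv
    { toFun := fun x => WithLp.toLp 2 fun k => w k * x k
      invFun := fun x => WithLp.toLp 2 fun k => (w k)⁻¹ * x k
      map_add' := fun x y => by ext k; simp [mul_add]
      map_smul' := fun r x => by ext k; simp; ring
      left_inv := fun x => by ext k; simp [hw k]
      right_inv := fun x => by ext k; simp [hw k] }

theorem diagEquiv_apply (w : Fin d → ℝ) (hw : ∀ k, w k ≠ 0) (x : EuclideanSpace ℝ (Fin d))
    (k : Fin d) : diagEquiv w hw x k = w k * x k := rfl

theorem diagEquiv_symm_apply (w : Fin d → ℝ) (hw : ∀ k, w k ≠ 0) (x : EuclideanSpace ℝ (Fin d))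
    (k : Fin d) : (diagEquiv w hw).symm x k = (w k)⁻¹ * x k := rfl

theorem inner_diagEquiv (w : Fin d → ℝ) (hw : ∀ k, w k ≠ 0) (x y : EuclideanSpace ℝ (Fin d)) :
    ⟪diagEquiv w hw x, y⟫ = ⟪x, diagEquiv w hw y⟫ := by
  simp only [PiLp.inner_apply, diagEquiv_apply, RCLike.inner_apply, conj_trivial]
  exact Finset.sum_congr rfl fun k _ => by ring

theorem norm_le_norm_diagEquiv (w : Fin d → ℝ) (hw : ∀ k, w k ≠ 0) (hw1 : ∀ k, 1 ≤ w k)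
    (x : EuclideanSpace ℝ (Fin d)) : ‖x‖ ≤ ‖diagEquiv w hw x‖ := by
  rw [EuclideanSpace.norm_eq, EuclideanSpace.norm_eq]
  refine Real.sqrt_le_sqrt (Finset.sum_le_sum fun k _ => ?_)
  rw [diagEquiv_apply, norm_mul, mul_pow]
  refine le_mul_of_one_le_left (by positivity) (one_le_pow₀ ?_)
  exact (hw1 k).trans (le_abs_self _)

theorem norm_le_sum_abs {ι : Type*} [Fintype ι] (x : EuclideanSpace ℝ ι) : ‖x‖ ≤ ∑ k, |x k| := by
  rw [EuclideanSpace.norm_eq]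
  refine Real.sqrt_le_iff.mpr ⟨Finset.sum_nonneg fun k _ => abs_nonneg _, ?_⟩
  exact Finset.sum_sq_le_sq_sum_of_nonneg fun k _ => abs_nonneg _

theorem inner_single_left (k : Fin d) (s : ℝ) (z : EuclideanSpace ℝ (Fin d)) :
    ⟪EuclideanSpace.single k s, z⟫ = s * z k := by
  rw [EuclideanSpace.inner_single_left]
  simp

variable {ν : Measure (EuclideanSpace ℝ (Fin d))}

/-- The second moment of the rescaled small jumps is controlled by the symbol on the axes, since
`1 - cos u` is comparable with `u²` for `|u| ≤ 1`. -/
theorem setIntegral_norm_sq_le (hν : IsLevyMeasure ν) (w : Fin d → ℝ) (hw : ∀ k, w k ≠ 0) :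
    ∫ z in {z | ‖diagEquiv w hw z‖ ≤ 1}, ‖diagEquiv w hw z‖ ^ 2 ∂ν
      ≤ 5 * ∑ k, (symbol ν (EuclideanSpace.single k (w k))).re := by
  have hint : Integrable (fun z => ∑ k, 5 * (1 - Real.cos ⟪EuclideanSpace.single k (w k), z⟫)) ν :=
    integrable_finsetSum _ fun k _ => (hν.integrable_one_sub_cos _).const_mul 5
  calc ∫ z in {z | ‖diagEquiv w hw z‖ ≤ 1}, ‖diagEquiv w hw z‖ ^ 2 ∂ν
      ≤ ∫ z in {z | ‖diagEquiv w hw z‖ ≤ 1},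
          ∑ k, 5 * (1 - Real.cos ⟪EuclideanSpace.single k (w k), z⟫) ∂ν := by
        refine setIntegral_mono_on (hν.integrableOn_norm_sq _) hint.integrableOn
          (measurableSet_norm_le_one _) fun z hz => ?_
        have hz' : ‖diagEquiv w hw z‖ ≤ 1 := hz
        rw [EuclideanSpace.norm_sq_eq]
        refine Finset.sum_le_sum fun k _ => ?_
        rw [diagEquiv_apply, inner_single_left, Real.norm_eq_abs, sq_abs]
        have h1 : |w k * z k| ≤ 1 := (PiLp.norm_apply_le (diagEquiv w hw z) k).trans hz'
        have h2 := Real.cos_le_one_sub_mul_cos_sq (h1.trans (by linarith [Real.pi_gt_three]))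
        have h3 : (1 : ℝ) / 5 ≤ 2 / Real.pi ^ 2 := by
          rw [div_le_div_iff₀ (by norm_num) (by positivity)]
          nlinarith [Real.pi_lt_d2, Real.pi_pos]
        nlinarith [sq_nonneg (w k * z k)]
    _ ≤ ∫ z, ∑ k, 5 * (1 - Real.cos ⟪EuclideanSpace.single k (w k), z⟫) ∂ν := by
        refine setIntegral_le_integral hint (Filter.Eventually.of_forall fun z => ?_)
        exact Finset.sum_nonneg fun k _ =>
          mul_nonneg (by norm_num) (sub_nonneg.mpr (Real.cos_le_one _))
    _ = 5 * ∑ k, (symbol ν (EuclideanSpace.single k (w k))).re := by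
        rw [integral_finsetSum _ fun k _ => (hν.integrable_one_sub_cos _).const_mul 5,
          Finset.mul_sum]
        refine Finset.sum_congr rfl fun k _ => ?_
        rw [integral_const_mul, hν.re_symbol]

/-- The oscillating part of the integral is at most `2 / |u| ≤ 2 / δ`, and the interval has length
`1 + 2 / δ`. -/
theorem one_le_integral_one_sub_cos {δ u : ℝ} (hδ : 0 < δ) (hu : δ ≤ |u|) :
    1 ≤ ∫ s in (1 : ℝ)..(2 + 2 / δ), (1 - Real.cos (s * u)) := by
  have hu0 : u ≠ 0 := by
    rintro rfl
    simp at hu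
    linarith
  have h1 : ∫ s in (1 : ℝ)..(2 + 2 / δ), Real.cos (s * u)
      = u⁻¹ * (Real.sin ((2 + 2 / δ) * u) - Real.sin (1 * u)) := by
    rw [intervalIntegral.integral_comp_mul_right (fun x => Real.cos x) hu0, integral_cos,
      smul_eq_mul]
  rw [intervalIntegral.integral_sub (by simp) (Continuous.intervalIntegrable (by fun_prop) _ _),
    h1, intervalIntegral.integral_const]
  have h2 : |u⁻¹ * (Real.sin ((2 + 2 / δ) * u) - Real.sin (1 * u))| ≤ 2 / δ := by
    rw [abs_mul, abs_inv, inv_mul_eq_div]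
    have : |Real.sin ((2 + 2 / δ) * u) - Real.sin (1 * u)| ≤ 2 := by
      refine (abs_sub _ _).trans ?_
      linarith [Real.abs_sin_le_one ((2 + 2 / δ) * u), Real.abs_sin_le_one (1 * u)]
    gcongr
  have h3 := (abs_le.mp h2).2
  simp only [smul_eq_mul, mul_one]
  linarith

/-- The mass of the large jumps is controlled by the symbol on the axes: the average of
`1 - cos (s u)` over an interval of `s` away from zero is bounded below for `|u| ≥ 1 / (d + 1)`. -/
theorem measureReal_compl_le (hν : IsLevyMeasure ν) (w : Fin d → ℝ) (hw : ∀ k, w k ≠ 0) {U : ℝ}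
    (hU : ∀ k, ∀ s ∈ Set.Icc (1 : ℝ) (2 * d + 4),
      (symbol ν (EuclideanSpace.single k (s * w k))).re ≤ U) :
    ν.real {z | ‖diagEquiv w hw z‖ ≤ 1}ᶜ ≤ d * ((2 * d + 3) * U) := by
  set B : Set (EuclideanSpace ℝ (Fin d)) := {z | ‖diagEquiv w hw z‖ ≤ 1}
  have hfin : IsFiniteMeasure (ν.restrict Bᶜ) :=
    ⟨by simpa using hν.measure_compl_lt_top (diagEquiv w hw)⟩
  set δ : ℝ := ((d : ℝ) + 1)⁻¹ with hδ
  have hδ0 : 0 < δ := by positivity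
  have hL : 2 + 2 / δ = 2 * d + 4 := by
    rw [hδ, div_inv_eq_mul]
    ring
  have hle : (1 : ℝ) ≤ 2 * d + 4 := by
    have : (0 : ℝ) ≤ d := Nat.cast_nonneg d
    linarith
  set G : Fin d → EuclideanSpace ℝ (Fin d) → ℝ → ℝ :=
    fun k z s => 1 - Real.cos ⟪EuclideanSpace.single k (s * w k), z⟫ with hG
  have hGe : ∀ k z s, G k z s = 1 - Real.cos (s * (w k * z k)) := fun k z s => by
    simp only [hG, inner_single_left, mul_assoc]
  have hG0 : ∀ k z s, 0 ≤ G k z s := fun k z s => sub_nonneg.mpr (Real.cos_le_one _)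
  have hGi : ∀ k, Integrable (Function.uncurry (G k))
      ((ν.restrict Bᶜ).prod (volume.restrict (Set.Ioc (1 : ℝ) (2 * d + 4)))) := by
    intro k
    refine (integrable_const (2 : ℝ)).mono' ?_ (Filter.Eventually.of_forall fun p => ?_)
    · refine Continuous.aestronglyMeasurable ?_
      have : Function.uncurry (G k) = fun p => 1 - Real.cos (p.2 * (w k * p.1 k)) :=
        funext fun p => hGe k p.1 p.2
      rw [this]
      fun_prop
    · change ‖G k p.1 p.2‖ ≤ 2
      rw [Real.norm_of_nonneg (hG0 _ _ _), hGe]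
      linarith [Real.neg_one_le_cos (p.2 * (w k * p.1 k))]
  have hpt : ∀ z ∈ Bᶜ, 1 ≤ ∑ k, ∫ s in Set.Ioc (1 : ℝ) (2 * d + 4), G k z s := by
    intro z hz
    have hz' : 1 < ‖diagEquiv w hw z‖ := not_le.mp hz
    obtain ⟨k, hk⟩ : ∃ k, δ ≤ |w k * z k| := by
      by_contra! hcon
      have h1 : ‖diagEquiv w hw z‖ ≤ ∑ _k : Fin d, δ :=
        (norm_le_sum_abs _).trans (Finset.sum_le_sum fun k _ => (hcon k).le)
      have h2 : ∑ _k : Fin d, δ ≤ 1 := by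
        rw [Finset.sum_const, Finset.card_univ, Fintype.card_fin, nsmul_eq_mul, hδ,
          mul_inv_le_iff₀ (by positivity)]
        linarith
      linarith
    have h3 := one_le_integral_one_sub_cos hδ0 hk
    rw [hL, intervalIntegral.integral_of_le hle] at h3
    have h4 : ∫ s in Set.Ioc (1 : ℝ) (2 * d + 4), G k z s
        ≤ ∑ k, ∫ s in Set.Ioc (1 : ℝ) (2 * d + 4), G k z s :=
      Finset.single_le_sum (f := fun k => ∫ s in Set.Ioc (1 : ℝ) (2 * d + 4), G k z s)
        (fun k _ => integral_nonneg fun s => hG0 k z s) (Finset.mem_univ k)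
    refine h3.trans (le_trans (le_of_eq ?_) h4)
    simp_rw [hGe]
  calc ν.real Bᶜ = ∫ _z in Bᶜ, (1 : ℝ) ∂ν := by simp
    _ ≤ ∫ z in Bᶜ, ∑ k, (∫ s in Set.Ioc (1 : ℝ) (2 * d + 4), G k z s) ∂ν := by
        refine setIntegral_mono_on (integrable_const _) ?_
          (measurableSet_norm_le_one _).compl hpt
        exact integrable_finsetSum _ fun k _ => (hGi k).integral_prod_left
    _ = ∑ k, ∫ z in Bᶜ, (∫ s in Set.Ioc (1 : ℝ) (2 * d + 4), G k z s) ∂ν :=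
        integral_finsetSum _ fun k _ => (hGi k).integral_prod_left
    _ = ∑ k, ∫ s in Set.Ioc (1 : ℝ) (2 * d + 4), (∫ z in Bᶜ, G k z s ∂ν) :=
        Finset.sum_congr rfl fun k _ => integral_integral_swap (hGi k)
    _ ≤ ∑ _k : Fin d, ∫ s in Set.Ioc (1 : ℝ) (2 * d + 4), U := by
        refine Finset.sum_le_sum fun k _ => ?_
        refine setIntegral_mono_on (hGi k).integral_prod_right (by simp) measurableSet_Ioc
          fun s hs => ?_
        refine le_trans ?_ (hU k s ⟨hs.1.le, hs.2⟩)
        rw [hν.re_symbol]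
        exact setIntegral_le_integral (hν.integrable_one_sub_cos _)
          (Filter.Eventually.of_forall fun z => hG0 k z s)
    _ = d * ((2 * d + 3) * U) := by
        simp [hle]
        left; left
        ring

/-- Any power of `1 + |ξ|` is absorbed by `exp (-c ∑ |ξ_k|^{a_k})`. -/
theorem exists_pow_mul_exp_neg_sum_rpow_le {a : Fin d → ℝ} (ha : ∀ k, 0 < a k) {c : ℝ}
    (hc : 0 < c) :
    ∃ D : ℕ → ℝ, ∀ (p : ℕ) (ξ : EuclideanSpace ℝ (Fin d)),
      (1 + ‖ξ‖) ^ p * Real.exp (-(c * ∑ k, |ξ k| ^ a k)) ≤ D p := by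
  obtain ⟨q, hq⟩ : ∃ q : ℕ, ∀ k, (a k)⁻¹ ≤ q := by
    obtain ⟨q, hq⟩ := exists_nat_ge (∑ k, (a k)⁻¹)
    exact ⟨q, fun k => (Finset.single_le_sum (f := fun k => (a k)⁻¹)
      (fun k _ => inv_nonneg.mpr (ha k).le) (Finset.mem_univ k)).trans hq⟩
  refine ⟨fun p => (1 + d) ^ p * ((q * p).factorial / c ^ (q * p) * Real.exp c), fun p ξ => ?_⟩
  set s := ∑ k, |ξ k| ^ a k with hs
  have hs0 : 0 ≤ s := Finset.sum_nonneg fun k _ => by positivity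
  have hk : ∀ k, |ξ k| ≤ (1 + s) ^ q := by
    intro k
    have h1 : |ξ k| ^ a k ≤ 1 + s := by
      have : |ξ k| ^ a k ≤ s := Finset.single_le_sum (f := fun k => |ξ k| ^ a k)
        (fun k _ => by positivity) (Finset.mem_univ k)
      linarith
    calc |ξ k| = (|ξ k| ^ a k) ^ (a k)⁻¹ := (Real.rpow_rpow_inv (abs_nonneg _) (ha k).ne').symm
      _ ≤ (1 + s) ^ (a k)⁻¹ :=
          Real.rpow_le_rpow (by positivity) h1 (inv_nonneg.mpr (ha k).le)
      _ ≤ (1 + s) ^ (q : ℝ) := Real.rpow_le_rpow_of_exponent_le (by linarith) (hq k)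
      _ = (1 + s) ^ q := Real.rpow_natCast _ _
  have hn : 1 + ‖ξ‖ ≤ (1 + d) * (1 + s) ^ q := by
    have h1 : ‖ξ‖ ≤ d * (1 + s) ^ q := by
      refine (norm_le_sum_abs ξ).trans ((Finset.sum_le_sum fun k _ => hk k).trans (le_of_eq ?_))
      simp
    have h2 : 1 ≤ (1 + s) ^ q := one_le_pow₀ (by linarith)
    linarith
  have hexp : (1 + s) ^ (q * p) ≤ (q * p).factorial / c ^ (q * p) * Real.exp (c * (1 + s)) := by
    have h1 := Real.pow_div_factorial_le_exp (x := c * (1 + s)) (by positivity) (q * p)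
    rw [div_le_iff₀ (by positivity), mul_pow] at h1
    rw [div_mul_eq_mul_div, le_div_iff₀ (by positivity)]
    linarith
  calc (1 + ‖ξ‖) ^ p * Real.exp (-(c * s))
      ≤ ((1 + d) * (1 + s) ^ q) ^ p * Real.exp (-(c * s)) := by gcongr
    _ = (1 + d) ^ p * ((1 + s) ^ (q * p) * Real.exp (-(c * s))) := by
        rw [mul_pow, ← pow_mul]
        ring
    _ ≤ (1 + d) ^ p * ((q * p).factorial / c ^ (q * p) * Real.exp (c * (1 + s))
          * Real.exp (-(c * s))) := by gcongr
    _ = (1 + d) ^ p * ((q * p).factorial / c ^ (q * p) * Real.exp c) := by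
        rw [mul_assoc (_ / _), ← Real.exp_add]
        ring_nf

end Anisotropic

/-! ### Smooth densities under anisotropic bounds on the symbol -/

section AnisotropicDensity

open scoped ContDiff

variable {d : ℕ} {ν : Measure (EuclideanSpace ℝ (Fin d))}

open LineDeriv in
/-- The `k`-th derivative of the density of `Z t` is, after rescaling by `w`, controlled by the
rescaled small jumps alone. -/
theorem smooth_density_of_isSmallJump (hν : IsLevyMeasure ν) {t : ℝ} (ht : 0 ≤ t)
    (w : Fin d → ℝ) (hw : ∀ k, w k ≠ 0) (hw1 : ∀ k, 1 ≤ w k) {K : ℝ} {D : ℕ → ℝ}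
    (h : IsSmallJump (smallJumps ν t (diagEquiv w hw)) K D)
    (μ : Measure (EuclideanSpace ℝ (Fin d))) [IsProbabilityMeasure μ]
    (hμ : ∀ ξ, charFun μ ξ = Complex.exp (-(t : ℂ) * symbol ν ξ))
    {f : EuclideanSpace ℝ (Fin d) → ℝ}
    (hf : ∀ x, f x = (𝓕 (fun η => charFun μ ((2 * Real.pi) • η)) x).re) :
    (∀ x, 0 ≤ f x) ∧ μ = (volume.withDensity fun x => ENNReal.ofReal (f x)) ∧
      ContDiff ℝ ∞ f ∧ ∀ k : Fin d,
        Integrable (fun z => fderiv ℝ f z (EuclideanSpace.single k 1)) ∧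
          ∫ z, |fderiv ℝ f z (EuclideanSpace.single k 1)| ≤ (2 * Real.pi * (w k)⁻¹)⁻¹ *
            ∫ x, ‖(∂_{(EuclideanSpace.single k 1 : EuclideanSpace ℝ (Fin d))}
              (𝓕 (expSymbol h)) : 𝓢(EuclideanSpace ℝ (Fin d), ℂ)) x‖ := by
  have hw0 : ∀ k, 0 < w k := fun k => one_pos.trans_le (hw1 k)
  obtain ⟨ρ, hρ, hρe⟩ := exists_exp_symbol_eq_charFun_mul hν ht (inner_diagEquiv w hw)
    fun z hz => (norm_le_norm_diagEquiv w hw hw1 z).trans hz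
  have hA0 : ∀ k, 2 * Real.pi * (w k)⁻¹ ≠ 0 := fun k => by
    have := hw0 k
    positivity
  obtain ⟨h1, h2, h3, h4⟩ := smooth_density_of_charFun_eq_mul μ ρ (expSymbol h)
    (diagEquiv (fun k => 2 * Real.pi * (w k)⁻¹) hA0) (inner_diagEquiv _ hA0)
    (fun η => by
      rw [hμ, hρe, expSymbol_apply]
      congr 4
      ext k
      rw [diagEquiv_symm_apply, diagEquiv_apply, PiLp.smul_apply, smul_eq_mul]
      ring) hf
  refine ⟨h1, h2, h3, fun k => h4 _ _ (by have := hw0 k; positivity) ?_⟩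
  ext j
  rw [diagEquiv_apply, PiLp.smul_apply, smul_eq_mul]
  by_cases hj : j = k
  · rw [hj]
  · simp [hj]

variable {a : Fin d → ℝ} {c K C₀ R : ℝ}

/-- A pure jump Lévy process in `ℝ^d` whose symbol is bounded below by `∑ |ξ_k|^{a_k}`, and above
by `|s|^{a_k}` on the `k`-th axis, has smooth densities with `‖∂_k f_t‖_{L¹} ≤ C t^{-1/a_k}` for
small `t`. -/
theorem exists_smooth_density_of_symbol_bounds (hν : IsLevyMeasure ν)
    (ha : ∀ k, a k ∈ Set.Ioo (0 : ℝ) 2) (hc : 0 < c) (hK : 0 ≤ K) (hC₀ : 0 < C₀)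
    (hlow : ∀ ξ, c * ∑ k, |ξ k| ^ a k - K ≤ (symbol ν ξ).re)
    (hup : ∀ k s, R ≤ s → 1 ≤ s → (symbol ν (EuclideanSpace.single k s)).re ≤ C₀ * s ^ a k)
    (μ : ℝ≥0 → Measure (EuclideanSpace ℝ (Fin d))) (hμP : ∀ t, IsProbabilityMeasure (μ t))
    (hμ : ∀ (t : ℝ≥0) ξ, charFun (μ t) ξ = Complex.exp (-((t : ℝ) : ℂ) * symbol ν ξ)) :
    ∃ f : ℝ≥0 → EuclideanSpace ℝ (Fin d) → ℝ,
      (∀ t, 0 < t → (∀ x, 0 ≤ f t x) ∧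
        μ t = (volume.withDensity fun x => ENNReal.ofReal (f t x)) ∧ ContDiff ℝ ∞ (f t)) ∧
      ∃ C : ℝ, 0 < C ∧ ∀ k, ∀ᶠ t in 𝓝[>] (0 : ℝ≥0),
        Integrable (fun z => fderiv ℝ (f t) z (EuclideanSpace.single k 1)) ∧
        ∫ z, |fderiv ℝ (f t) z (EuclideanSpace.single k 1)| ≤ C * (t : ℝ) ^ (-1 / a k) := by
  refine ⟨fun t x => (𝓕 (fun η => charFun (μ t) ((2 * Real.pi) • η)) x).re, fun t ht => ?_, ?_⟩
  · -- for a fixed time no uniformity is needed, and jumps are cut at size one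
    have ht' : (0 : ℝ) < t := ht
    have hw : ∀ _k : Fin d, (1 : ℝ) ≠ 0 := fun _ => one_ne_zero
    have hS : ∀ ξ, diagEquiv (fun _ : Fin d => (1 : ℝ)) hw ξ = ξ := fun ξ => by
      ext k
      rw [diagEquiv_apply, one_mul]
    obtain ⟨D, hD⟩ := exists_pow_mul_exp_neg_sum_rpow_le (fun k => (ha k).1) (mul_pos ht' hc)
    have h := isSmallJump_smallJumps hν ht'.le (inner_diagEquiv _ hw)
      (fun z hz => (norm_le_norm_diagEquiv _ hw (fun _ => le_rfl) z).trans hz)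
      (D := fun p => Real.exp (t * K) * D p) (le_max_left _ _) (le_max_right _ _) fun p ξ => by
        rw [hS]
        calc (1 + ‖ξ‖) ^ p * Real.exp (-(t * (symbol ν ξ).re))
            ≤ (1 + ‖ξ‖) ^ p * Real.exp (t * K + -(t * c * ∑ k, |ξ k| ^ a k)) := by
              gcongr
              have := mul_le_mul_of_nonneg_left (hlow ξ) ht'.le
              linarith
          _ = Real.exp (t * K) * ((1 + ‖ξ‖) ^ p * Real.exp (-(t * c * ∑ k, |ξ k| ^ a k))) := by
              rw [Real.exp_add]
              ring
          _ ≤ Real.exp (t * K) * D p := by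
              gcongr
              exact hD p ξ
    have hP := hμP t
    obtain ⟨h1, h2, h3, -⟩ := smooth_density_of_isSmallJump hν ht'.le _ hw (fun _ => le_rfl) h
      (μ t) (hμ t) (fun x => rfl)
    exact ⟨h1, h2, h3⟩
  · obtain ⟨D, hD⟩ := exists_pow_mul_exp_neg_sum_rpow_le (fun k => (ha k).1) hc
    -- the bounds of the rescaled small jumps, uniformly in small times
    set U : ℝ := C₀ * (2 * d + 4) ^ 2 with hU
    have hU0 : 0 < U := by positivity
    set K' : ℝ := max (5 * (d * U)) (d * ((2 * d + 3) * U)) with hK'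
    set D' : ℕ → ℝ := fun p => Real.exp (2 * K') * (Real.exp K * D p) with hD'
    choose M hM using fun k : Fin d => exists_integral_lineDeriv_fourier_expSymbol_le K' D'
      (EuclideanSpace.single k (1 : ℝ))
    refine ⟨(∑ k, |M k|) + 1, by positivity, fun k₀ => ?_⟩
    set Rm : ℝ := max R 1 with hRm
    have hRm1 : 1 ≤ Rm := le_max_right _ _
    have hsmall : ∀ᶠ t : ℝ≥0 in 𝓝[>] 0, (t : ℝ) < (Rm ^ 2)⁻¹ := by
      refine nhdsWithin_le_nhds ?_
      exact (NNReal.continuous_coe.tendsto 0).eventually_lt_const (by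
        simp only [NNReal.coe_zero]
        positivity)
    filter_upwards [hsmall, self_mem_nhdsWithin] with t htR ht
    have ht' : (0 : ℝ) < t := ht
    have ht1 : (t : ℝ) ≤ 1 := htR.le.trans (inv_le_one_of_one_le₀ (one_le_pow₀ hRm1))
    -- the scaling `w k = t^{-1/a_k}`
    set w : Fin d → ℝ := fun k => (t : ℝ) ^ (-1 / a k) with hwdef
    have hw0 : ∀ k, 0 < w k := fun k => Real.rpow_pos_of_pos ht' _
    have hw : ∀ k, w k ≠ 0 := fun k => (hw0 k).ne'
    have hwa : ∀ k, w k ^ a k = (t : ℝ)⁻¹ := fun k => by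
      rw [hwdef, ← Real.rpow_mul ht'.le, div_mul_cancel₀ _ (ha k).1.ne', Real.rpow_neg_one]
    have hwR : ∀ k, Rm ≤ w k := fun k => by
      have h1 : Rm ^ a k ≤ w k ^ a k := by
        rw [hwa]
        calc Rm ^ a k ≤ Rm ^ (2 : ℝ) := Real.rpow_le_rpow_of_exponent_le hRm1 (ha k).2.le
          _ = Rm ^ 2 := Real.rpow_ofNat _ _
          _ ≤ (t : ℝ)⁻¹ := (le_inv_comm₀ (by positivity) ht').mpr htR.le
      exact (Real.rpow_le_rpow_iff (by positivity) (hw0 k).le (ha k).1).mp h1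
    have hw1 : ∀ k, 1 ≤ w k := fun k => hRm1.trans (hwR k)
    have haxis : ∀ k, ∀ s ∈ Set.Icc (1 : ℝ) (2 * d + 4),
        (symbol ν (EuclideanSpace.single k (s * w k))).re ≤ U / t := by
      intro k s hs
      have hs0 : 0 ≤ s := zero_le_one.trans hs.1
      have hsw : Rm ≤ s * w k := (hwR k).trans (le_mul_of_one_le_left (hw0 k).le hs.1)
      refine (hup k _ ((le_max_left _ _).trans hsw) (hRm1.trans hsw)).trans ?_
      rw [Real.mul_rpow hs0 (hw0 k).le, hwa, ← mul_assoc, ← div_eq_mul_inv, hU]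
      gcongr
      calc s ^ a k ≤ s ^ (2 : ℝ) := Real.rpow_le_rpow_of_exponent_le hs.1 (ha k).2.le
        _ = s ^ 2 := Real.rpow_ofNat _ _
        _ ≤ (2 * d + 4) ^ 2 := pow_le_pow_left₀ hs0 hs.2 2
    have hsq : t * ∫ z in {z | ‖diagEquiv w hw z‖ ≤ 1}, ‖diagEquiv w hw z‖ ^ 2 ∂ν ≤ K' := by
      have h1 : ∑ k, (symbol ν (EuclideanSpace.single k (w k))).re ≤ d * (U / t) := by
        refine (Finset.sum_le_sum (g := fun _ => U / t) fun k _ => ?_).trans (le_of_eq ?_)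
        · have := haxis k 1 ⟨le_rfl, by have : (0 : ℝ) ≤ d := Nat.cast_nonneg d
                                        linarith⟩
          rwa [one_mul] at this
        · simp
      calc t * ∫ z in {z | ‖diagEquiv w hw z‖ ≤ 1}, ‖diagEquiv w hw z‖ ^ 2 ∂ν
          ≤ t * (5 * (d * (U / t))) := by
            gcongr
            exact (setIntegral_norm_sq_le hν w hw).trans (by gcongr)
        _ = 5 * (d * U) := by field_simp
        _ ≤ K' := le_max_left _ _
    have htail : t * ν.real {z | ‖diagEquiv w hw z‖ ≤ 1}ᶜ ≤ K' := by
      calc t * ν.real {z | ‖diagEquiv w hw z‖ ≤ 1}ᶜ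
          ≤ t * (d * ((2 * d + 3) * (U / t))) := by
            gcongr
            exact measureReal_compl_le hν w hw haxis
        _ = d * ((2 * d + 3) * U) := by field_simp
        _ ≤ K' := le_max_right _ _
    have h : IsSmallJump (smallJumps ν t (diagEquiv w hw)) K' D' := by
      refine isSmallJump_smallJumps hν ht'.le (inner_diagEquiv _ hw)
        (fun z hz => (norm_le_norm_diagEquiv _ hw hw1 z).trans hz) hsq htail fun p ξ => ?_
      have h1 := mul_le_mul_of_nonneg_left (hlow (diagEquiv w hw ξ)) ht'.le
      have h2 : ∑ k, |diagEquiv w hw ξ k| ^ a k = (t : ℝ)⁻¹ * ∑ k, |ξ k| ^ a k := by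
        rw [Finset.mul_sum]
        refine Finset.sum_congr rfl fun k _ => ?_
        rw [diagEquiv_apply, abs_mul, Real.mul_rpow (abs_nonneg _) (abs_nonneg _),
          abs_of_pos (hw0 k), hwa]
      have h3 : (t : ℝ) * (c * ((t : ℝ)⁻¹ * ∑ k, |ξ k| ^ a k) - K)
          = c * ∑ k, |ξ k| ^ a k - t * K := by field_simp
      rw [h2, h3] at h1
      calc (1 + ‖ξ‖) ^ p * Real.exp (-(t * (symbol ν (diagEquiv w hw ξ)).re))
          ≤ (1 + ‖ξ‖) ^ p * Real.exp (K + -(c * ∑ k, |ξ k| ^ a k)) := by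
            gcongr
            nlinarith
        _ = Real.exp K * ((1 + ‖ξ‖) ^ p * Real.exp (-(c * ∑ k, |ξ k| ^ a k))) := by
            rw [Real.exp_add]
            ring
        _ ≤ Real.exp K * D p := by
            gcongr
            exact hD p ξ
    have hP := hμP t
    obtain ⟨-, -, -, h4⟩ := smooth_density_of_isSmallJump hν ht'.le _ hw hw1 h
      (μ t) (hμ t) (fun x => rfl)
    refine ⟨(h4 k₀).1, (h4 k₀).2.trans ?_⟩
    have hMk : |M k₀| ≤ ∑ k, |M k| :=
      Finset.single_le_sum (f := fun k => |M k|) (fun k _ => abs_nonneg _) (Finset.mem_univ k₀)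
    calc (2 * Real.pi * (w k₀)⁻¹)⁻¹ * _ ≤ (2 * Real.pi * (w k₀)⁻¹)⁻¹ * ((∑ k, |M k|) + 1) := by
          refine mul_le_mul_of_nonneg_left ?_ (by have := hw0 k₀; positivity)
          exact (hM k₀ _ h).trans (by linarith [le_abs_self (M k₀)])
      _ = (2 * Real.pi)⁻¹ * (((∑ k, |M k|) + 1) * w k₀) := by
          rw [mul_inv, inv_inv]
          ring
      _ ≤ 1 * (((∑ k, |M k|) + 1) * w k₀) := by
          have h5 : 0 ≤ ((∑ k, |M k|) + 1) * w k₀ := by have := hw0 k₀; positivity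
          refine mul_le_mul_of_nonneg_right (inv_le_one_of_one_le₀ ?_) h5
          linarith [Real.pi_gt_three]
      _ = ((∑ k, |M k|) + 1) * (t : ℝ) ^ (-1 / a k₀) := one_mul _

end AnisotropicDensity

/-! ### The Lévy measure of a process with independent blocks -/

section Blocks

variable {d m : ℕ}

/-- Extension by zero `ℝ^J → ℝ^d`. -/
noncomputable def extendZero (J : Finset (Fin d)) :
    EuclideanSpace ℝ J →ₗ[ℝ] EuclideanSpace ℝ (Fin d) where
  toFun x := WithLp.toLp 2 fun k => if h : k ∈ J then x ⟨k, h⟩ else 0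
  map_add' x y := by
    ext k
    by_cases h : k ∈ J <;> simp [h]
  map_smul' r x := by
    ext k
    by_cases h : k ∈ J <;> simp [h]

theorem extendZero_apply (J : Finset (Fin d)) (x : EuclideanSpace ℝ J) (k : Fin d) :
    extendZero J x k = if h : k ∈ J then x ⟨k, h⟩ else 0 := rfl

/-- The restriction `ℝ^d → ℝ^J` of the coordinates to `J`. -/
noncomputable def restrictCoords (J : Finset (Fin d)) (ξ : EuclideanSpace ℝ (Fin d)) :
    EuclideanSpace ℝ J := WithLp.toLp 2 fun k => ξ k

theorem inner_extendZero (J : Finset (Fin d)) (ξ : EuclideanSpace ℝ (Fin d))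
    (x : EuclideanSpace ℝ J) : ⟪ξ, extendZero J x⟫ = ⟪restrictCoords J ξ, x⟫ := by
  simp only [PiLp.inner_apply, RCLike.inner_apply, conj_trivial, extendZero_apply, restrictCoords]
  rw [← Finset.sum_subset (Finset.subset_univ J), ← Finset.sum_coe_sort J]
  · exact Finset.sum_congr rfl fun k _ => by simp
  · intro k _ hk
    simp [hk]

theorem restrictCoords_extendZero (J : Finset (Fin d)) (x : EuclideanSpace ℝ J) :
    restrictCoords J (extendZero J x) = x := by
  ext k
  simp [restrictCoords, extendZero_apply]

theorem norm_extendZero (J : Finset (Fin d)) (x : EuclideanSpace ℝ J) :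
    ‖extendZero J x‖ = ‖x‖ := by
  have h := inner_extendZero J (extendZero J x) x
  rw [restrictCoords_extendZero, real_inner_self_eq_norm_sq, real_inner_self_eq_norm_sq] at h
  exact (pow_left_inj₀ (norm_nonneg _) (norm_nonneg _) two_ne_zero).mp h

theorem measurable_extendZero (J : Finset (Fin d)) : Measurable (extendZero J) :=
  (LinearMap.continuous_of_finiteDimensional _).measurable

theorem ofBlocks_eq_sum (I : Fin m → Finset (Fin d)) (x : ∀ j, EuclideanSpace ℝ (I j)) :
    ofBlocks I x = ∑ j, extendZero (I j) (x j) := by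
  ext k
  simp [ofBlocks, extendZero_apply]

/-- The Lévy measure on `ℝ^d` of a process with independent blocks, carried by the union of the
coordinate subspaces. -/
noncomputable def blockLevyMeasure (I : Fin m → Finset (Fin d))
    (ν : ∀ j, Measure (EuclideanSpace ℝ (I j))) : Measure (EuclideanSpace ℝ (Fin d)) :=
  ∑ j, (ν j).map (extendZero (I j))

variable {I : Fin m → Finset (Fin d)} {ν : ∀ j, Measure (EuclideanSpace ℝ (I j))}

theorem isLevyMeasure_map_extendZero {J : Finset (Fin d)} {ν : Measure (EuclideanSpace ℝ J)}
    (hν : IsLevyMeasure ν) : IsLevyMeasure (ν.map (extendZero J)) := by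
  constructor
  · rw [Measure.map_apply (measurable_extendZero J) (measurableSet_singleton 0)]
    convert! hν.1
    ext x
    rw [Set.mem_preimage, Set.mem_singleton_iff, Set.mem_singleton_iff, ← norm_eq_zero,
      norm_extendZero, norm_eq_zero]
  · rw [lintegral_map (by fun_prop) (measurable_extendZero J)]
    simp_rw [norm_extendZero]
    exact hν.2

theorem isLevyMeasure_blockLevyMeasure (hν : ∀ j, IsLevyMeasure (ν j)) :
    IsLevyMeasure (blockLevyMeasure I ν) := by
  constructor
  · rw [blockLevyMeasure, Measure.finsetSum_apply]
    exact Finset.sum_eq_zero fun j _ => (isLevyMeasure_map_extendZero (hν j)).1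
  · rw [blockLevyMeasure, lintegral_finsetSum_measure]
    exact ENNReal.sum_lt_top.mpr fun j _ => (isLevyMeasure_map_extendZero (hν j)).2

theorem symbol_map_extendZero {J : Finset (Fin d)} (ν : Measure (EuclideanSpace ℝ J))
    (ξ : EuclideanSpace ℝ (Fin d)) :
    symbol (ν.map (extendZero J)) ξ = symbol ν (restrictCoords J ξ) := by
  rw [symbol, integral_map (measurable_extendZero J).aemeasurable]
  · simp_rw [norm_extendZero, inner_extendZero]
    rfl
  · have h : MeasurableSet {z : EuclideanSpace ℝ (Fin d) | ‖z‖ ≤ 1} :=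
      measurableSet_le measurable_norm measurable_const
    exact ((measurable_const.add (Measurable.ite h (by fun_prop) measurable_const)).sub
      (by fun_prop)).aestronglyMeasurable

theorem symbol_blockLevyMeasure (hν : ∀ j, IsLevyMeasure (ν j)) (ξ : EuclideanSpace ℝ (Fin d)) :
    symbol (blockLevyMeasure I ν) ξ = ∑ j, symbol (ν j) (restrictCoords (I j) ξ) := by
  rw [symbol, blockLevyMeasure, integral_finsetSum_measure fun j _ =>
    (isLevyMeasure_map_extendZero (hν j)).integrable_symbol ξ]
  exact Finset.sum_congr rfl fun j _ => symbol_map_extendZero (ν j) ξ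

theorem charFun_map_extendZero {Ω : Type*} [MeasurableSpace Ω] (P : Measure Ω)
    {J : Finset (Fin d)} {X : Ω → EuclideanSpace ℝ J} (hX : Measurable X)
    (ξ : EuclideanSpace ℝ (Fin d)) :
    charFun (P.map fun ω => extendZero J (X ω)) ξ = charFun (P.map X) (restrictCoords J ξ) := by
  have hm : Measurable fun ω => extendZero J (X ω) := (measurable_extendZero J).comp hX
  rw [charFun_apply, charFun_apply, integral_map hm.aemeasurable
      (Continuous.aestronglyMeasurable (by fun_prop)),
    integral_map hX.aemeasurable (Continuous.aestronglyMeasurable (by fun_prop))]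
  simp_rw [real_inner_comm _ (extendZero J _), inner_extendZero, real_inner_comm]

theorem charFun_map_ofBlocks {Ω : Type*} [MeasurableSpace Ω] {P : Measure Ω}
    {X : ∀ j, Ω → EuclideanSpace ℝ (I j)} (hX : ∀ j, Measurable (X j)) (hind : iIndepFun X P)
    (ξ : EuclideanSpace ℝ (Fin d)) :
    charFun (P.map fun ω => ofBlocks I fun j => X j ω) ξ
      = ∏ j, charFun (P.map (X j)) (restrictCoords (I j) ξ) := by
  have h1 : iIndepFun (fun j ω => extendZero (I j) (X j ω)) P :=
    hind.comp (fun j => ⇑(extendZero (I j))) fun j => measurable_extendZero _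
  have hm : ∀ j, Measurable fun ω => extendZero (I j) (X j ω) := fun j =>
    (measurable_extendZero _).comp (hX j)
  simp_rw [ofBlocks_eq_sum]
  rw [h1.charFun_map_fun_sum_eq_prod fun j => (hm j).aemeasurable, Finset.prod_apply]
  refine Finset.prod_congr rfl fun j _ => ?_
  rw [charFun_map_extendZero P (hX j)]

theorem measurable_ofBlocks {Ω : Type*} [MeasurableSpace Ω] {X : ∀ j, Ω → EuclideanSpace ℝ (I j)}
    (hX : ∀ j, Measurable (X j)) : Measurable fun ω => ofBlocks I fun j => X j ω := by
  simp_rw [ofBlocks_eq_sum]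
  exact Finset.measurable_sum _ fun j _ => (measurable_extendZero _).comp (hX j)

theorem abs_rpow_sum_le {ι : Type*} [Fintype ι] {a : ℝ} (ha : 0 ≤ a) (x : EuclideanSpace ℝ ι) :
    ∑ k, |x k| ^ a ≤ Fintype.card ι * ‖x‖ ^ a := by
  calc ∑ k, |x k| ^ a ≤ ∑ _k : ι, ‖x‖ ^ a := by
        refine Finset.sum_le_sum fun k _ => Real.rpow_le_rpow (abs_nonneg _) ?_ ha
        exact PiLp.norm_apply_le x k
    _ = Fintype.card ι * ‖x‖ ^ a := by simp

variable {α : Fin m → ℝ} {c C₀ R : ℝ}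

/-- Subtracting a constant extends the lower bound to all frequencies, as the real part of the
symbol is nonnegative. -/
theorem re_symbol_ge_of_le {J : Finset (Fin d)} {ν : Measure (EuclideanSpace ℝ J)}
    (hν : IsLevyMeasure ν) {a : ℝ} (ha : a ∈ Set.Ioo (0 : ℝ) 2) (hc : 0 < c)
    (hlow : ∀ η, R ≤ ‖η‖ → c * ‖η‖ ^ a ≤ (symbol ν η).re) (η : EuclideanSpace ℝ J) :
    c * ‖η‖ ^ a - c * max R 1 ^ 2 ≤ (symbol ν η).re := by
  rcases le_total R ‖η‖ with h | h
  · have := hlow η h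
    have : 0 ≤ c * max R 1 ^ 2 := by positivity
    linarith
  · have h1 : ‖η‖ ^ a ≤ max R 1 ^ 2 := by
      calc ‖η‖ ^ a ≤ (max R 1) ^ a :=
            Real.rpow_le_rpow (norm_nonneg _) (h.trans (le_max_left _ _)) ha.1.le
        _ ≤ (max R 1) ^ (2 : ℝ) :=
            Real.rpow_le_rpow_of_exponent_le (le_max_right _ _) ha.2.le
        _ = max R 1 ^ 2 := Real.rpow_ofNat _ _
    have := hν.re_symbol_nonneg η
    have := mul_le_mul_of_nonneg_left h1 hc.le
    linarith

theorem re_symbol_blockLevyMeasure_ge (hd : 1 ≤ d) (hν : ∀ j, IsLevyMeasure (ν j))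
    (hcover : ∀ k : Fin d, ∃ j, k ∈ I j)
    (hα : ∀ j, α j ∈ Set.Ioo (0 : ℝ) 2) {a : Fin d → ℝ} (ha : ∀ j, ∀ k ∈ I j, a k = α j)
    (hc : 0 < c)
    (hlow : ∀ j η, R ≤ ‖η‖ → c * ‖η‖ ^ α j ≤ (symbol (ν j) η).re)
    (ξ : EuclideanSpace ℝ (Fin d)) :
    c / d * ∑ k, |ξ k| ^ a k - m * (c * max R 1 ^ 2)
      ≤ (symbol (blockLevyMeasure I ν) ξ).re := by
  have hd0 : (0 : ℝ) < d := by exact_mod_cast hd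
  have hblock : ∀ j, c / d * ∑ k ∈ I j, |ξ k| ^ a k - c * max R 1 ^ 2
      ≤ (symbol (ν j) (restrictCoords (I j) ξ)).re := by
    intro j
    refine le_trans ?_ (re_symbol_ge_of_le (hν j) (hα j) hc (hlow j) _)
    have h1 := abs_rpow_sum_le (hα j).1.le (restrictCoords (I j) ξ)
    have h2 : ∑ k ∈ I j, |ξ k| ^ a k = ∑ k, |restrictCoords (I j) ξ k| ^ α j := by
      rw [← Finset.sum_coe_sort]
      exact Finset.sum_congr rfl fun k _ => by rw [ha j k k.2]; rfl
    have h3 : (Fintype.card (I j) : ℝ) ≤ d := by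
      have := Finset.card_le_univ (I j)
      rw [Fintype.card_fin] at this
      rw [Fintype.card_coe]
      exact_mod_cast this
    have h4 : c / d * ∑ k ∈ I j, |ξ k| ^ a k ≤ c * ‖restrictCoords (I j) ξ‖ ^ α j := by
      rw [h2, div_mul_eq_mul_div, div_le_iff₀ hd0, mul_assoc]
      refine mul_le_mul_of_nonneg_left (h1.trans ?_) hc.le
      rw [mul_comm]
      gcongr
    linarith
  have hsum : ∑ k, |ξ k| ^ a k ≤ ∑ j, ∑ k ∈ I j, |ξ k| ^ a k := by
    calc ∑ k, |ξ k| ^ a k ≤ ∑ k, ∑ j, if k ∈ I j then |ξ k| ^ a k else 0 := by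
          refine Finset.sum_le_sum fun k _ => ?_
          obtain ⟨j, hj⟩ := hcover k
          refine (if_pos hj).ge.trans (Finset.single_le_sum
            (f := fun j => if k ∈ I j then |ξ k| ^ a k else 0) (fun i _ => ?_)
            (Finset.mem_univ j))
          dsimp only
          split_ifs <;> positivity
      _ = ∑ j, ∑ k ∈ I j, |ξ k| ^ a k := by
          rw [Finset.sum_comm]
          simp
  rw [symbol_blockLevyMeasure hν, Complex.re_sum]
  calc c / d * ∑ k, |ξ k| ^ a k - m * (c * max R 1 ^ 2)
      ≤ c / d * ∑ j, ∑ k ∈ I j, |ξ k| ^ a k - m * (c * max R 1 ^ 2) := by gcongr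
    _ = ∑ j, (c / d * ∑ k ∈ I j, |ξ k| ^ a k - c * max R 1 ^ 2) := by
        rw [Finset.sum_sub_distrib, Finset.mul_sum]
        simp
    _ ≤ ∑ j, (symbol (ν j) (restrictCoords (I j) ξ)).re := Finset.sum_le_sum fun j _ => hblock j

theorem re_symbol_blockLevyMeasure_single_le (hν : ∀ j, IsLevyMeasure (ν j))
    (hdisj : Pairwise fun i j => Disjoint (I i) (I j))
    (hup : ∀ j η, R ≤ ‖η‖ → (symbol (ν j) η).re ≤ C₀ * ‖η‖ ^ α j) {j : Fin m} {k : Fin d}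
    (hk : k ∈ I j) {s : ℝ} (hs : R ≤ s) (hs1 : 1 ≤ s) :
    (symbol (blockLevyMeasure I ν) (EuclideanSpace.single k s)).re ≤ C₀ * s ^ α j := by
  rw [symbol_blockLevyMeasure hν, Finset.sum_eq_single j]
  · have h1 : restrictCoords (I j) (EuclideanSpace.single k s)
        = EuclideanSpace.single (⟨k, hk⟩ : I j) s := by
      ext i
      simp [restrictCoords, Subtype.ext_iff]
    have h2 : ‖restrictCoords (I j) (EuclideanSpace.single k s)‖ = s := by
      rw [h1, PiLp.norm_single, Real.norm_of_nonneg (zero_le_one.trans hs1)]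
    have := hup j (restrictCoords (I j) (EuclideanSpace.single k s)) (by rwa [h2])
    rwa [h2] at this
  · intro i _ hij
    have h1 : restrictCoords (I i) (EuclideanSpace.single k s) = 0 := by
      ext l
      have : (l : Fin d) ≠ k := fun h =>
        Finset.disjoint_left.mp (hdisj hij) l.2 (h ▸ hk)
      simp [restrictCoords, this]
    rw [h1]
    simp [symbol]
  · simp

end Blocks

/-! ### From partial derivatives to partial gradients and translates -/

section Gradient

variable {d : ℕ}

theorem integrable_partialGrad_of_integrable (J : Finset (Fin d))
    {f : EuclideanSpace ℝ (Fin d) → ℝ} (hf : ContDiff ℝ 1 f) {B : ℝ}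
    (hi : ∀ k ∈ J, Integrable (fun z => fderiv ℝ f z (EuclideanSpace.single k 1)))
    (hB : ∀ k ∈ J, ∫ z, |fderiv ℝ f z (EuclideanSpace.single k 1)| ≤ B) :
    Integrable (partialGrad J f) ∧ ∫ z, ‖partialGrad J f z‖ ≤ J.card * B := by
  have hle : ∀ z, ‖partialGrad J f z‖
      ≤ ∑ k : J, |fderiv ℝ f z (EuclideanSpace.single (k : Fin d) 1)| := fun z =>
    norm_le_sum_abs (partialGrad J f z)
  have hsi : Integrable fun z =>
      ∑ k : J, |fderiv ℝ f z (EuclideanSpace.single (k : Fin d) 1)| :=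
    integrable_finsetSum _ fun k _ => (hi k k.2).abs
  have hc : Continuous (partialGrad J f) := by
    refine (PiLp.continuous_toLp 2 _).comp (continuous_pi fun k => ?_)
    exact (hf.continuous_fderiv one_ne_zero).clm_apply continuous_const
  have hint : Integrable (partialGrad J f) :=
    hsi.mono' hc.aestronglyMeasurable (Filter.Eventually.of_forall hle)
  refine ⟨hint, (integral_mono hint.norm hsi hle).trans ?_⟩
  rw [integral_finsetSum _ fun (k : J) _ => (hi k k.2).abs]
  refine (Finset.sum_le_sum (g := fun _ => B) fun (k : J) _ => hB k k.2).trans (le_of_eq ?_)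
  simp

theorem lintegral_translate_single_le {f : EuclideanSpace ℝ (Fin d) → ℝ} (hf : ContDiff ℝ 1 f)
    {k : Fin d} (hi : Integrable (fun z => fderiv ℝ f z (EuclideanSpace.single k 1))) {B : ℝ}
    (hB : ∫ z, |fderiv ℝ f z (EuclideanSpace.single k 1)| ≤ B) (h : ℝ) :
    ∫⁻ z, ENNReal.ofReal |f (z + EuclideanSpace.single k h) - f z|
      ≤ ENNReal.ofReal (|h| * B) := by
  have hsm : (EuclideanSpace.single k h : EuclideanSpace ℝ (Fin d))
      = h • EuclideanSpace.single k 1 := by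
    ext j
    by_cases hj : j = k <;> simp [hj]
  refine (lintegral_translate_sub_le hf (EuclideanSpace.single k h)).trans ?_
  simp_rw [hsm, map_smul, smul_eq_mul, abs_mul]
  rw [← ofReal_integral_eq_lintegral_ofReal (hi.abs.const_mul _)
    (Filter.Eventually.of_forall fun z => by positivity), integral_const_mul]
  exact ENNReal.ofReal_le_ofReal (mul_le_mul_of_nonneg_left hB (abs_nonneg h))

end Gradient

end AnisoLevy

theorem mainTheorem9
    {Ω : Type*} [MeasurableSpace Ω] (P : Measure Ω) [IsProbabilityMeasure P]
    (d m : ℕ) (hd : 1 ≤ d) (hmd : m ≤ d)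
    (I : Fin m → Finset (Fin d))
    (hdisj : Pairwise fun i j => Disjoint (I i) (I j))
    (hcover : ∀ k : Fin d, ∃ j, k ∈ I j)
    (Zb : ∀ j : Fin m, ℝ≥0 → Ω → EuclideanSpace ℝ (I j))
    (ν : ∀ j : Fin m, Measure (EuclideanSpace ℝ (I j)))
    (hZb : ∀ j, IsPureJumpLevy P (Zb j) (ν j))
    (hindep : iIndepFun (fun (j : Fin m) (ω : Ω) (t : ℝ≥0) => Zb j t ω) P)
    (α : Fin m → ℝ) (hα : ∀ j, α j ∈ Set.Ioo (0 : ℝ) 2)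
    (c C₀ R : ℝ) (hc : 0 < c) (hC₀ : 0 < C₀)
    (hbound : ∀ (j : Fin m) (ξ : EuclideanSpace ℝ (I j)), R ≤ ‖ξ‖ →
      c * ‖ξ‖ ^ α j ≤ (symbol (ν j) ξ).re ∧ (symbol (ν j) ξ).re ≤ C₀ * ‖ξ‖ ^ α j) :
    (∃ f : ℝ≥0 → EuclideanSpace ℝ (Fin d) → ℝ,
      (∀ t, 0 < t →
        IsDensity P (fun ω => ofBlocks I fun j => Zb j t ω) (f t) ∧ ContDiff ℝ (⊤ : ℕ∞) (f t)) ∧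
      ∃ C : ℝ, 0 < C ∧ ∀ j, ∀ᶠ t in 𝓝[>] (0 : ℝ≥0),
        Integrable (partialGrad (I j) (f t)) ∧
        ∫ z, ‖partialGrad (I j) (f t) z‖ ≤ C * (t : ℝ) ^ (-1 / α j)) ∧
    ∃ a : Fin d → ℝ, (∀ j, ∀ k ∈ I j, a k = α j) ∧
      ConditionA1With P (fun t ω => ofBlocks I fun j => Zb j t ω) a := by
  choose J hJ using hcover
  have ha : ∀ j, ∀ k ∈ I j, α (J k) = α j := by
    intro j k hk
    by_contra hne
    have hne' : J k ≠ j := fun h => hne (by rw [h])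
    exact Finset.disjoint_left.mp (hdisj hne') (hJ k) hk
  have hd0 : (0 : ℝ) < d := by exact_mod_cast hd
  have hν : ∀ j, IsLevyMeasure (ν j) := fun j => (hZb j).isLevyMeasure
  have hmeas : ∀ j t, Measurable (Zb j t) := fun j => (hZb j).1.measurable
  have hZm : ∀ t, Measurable fun ω => ofBlocks I fun j => Zb j t ω :=
    fun t => measurable_ofBlocks fun j => hmeas j t
  obtain ⟨f, hf, C, hC, hfC⟩ := exists_smooth_density_of_symbol_bounds
    (isLevyMeasure_blockLevyMeasure hν) (a := fun k => α (J k)) (fun k => hα (J k))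
    (c := c / d) (K := m * (c * max R 1 ^ 2)) (by positivity) (by positivity) hC₀
    (re_symbol_blockLevyMeasure_ge hd hν (fun k => ⟨J k, hJ k⟩) hα ha hc
      fun j η hη => (hbound j η hη).1)
    (fun k s hs hs1 => re_symbol_blockLevyMeasure_single_le hν hdisj
      (fun j η hη => (hbound j η hη).2) (hJ k) hs hs1)
    (fun t => P.map fun ω => ofBlocks I fun j => Zb j t ω)
    (fun t => Measure.isProbabilityMeasure_map (hZm t).aemeasurable)
    (fun t ξ => by
      have hind : iIndepFun (fun j => Zb j t) P :=
        hindep.comp (fun _ g => g t) fun _ => measurable_pi_apply t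
      rw [charFun_map_ofBlocks (fun j => hmeas j t) hind, symbol_blockLevyMeasure hν,
        Finset.mul_sum, Complex.exp_sum]
      exact Finset.prod_congr rfl fun j _ => (hZb j).charFun_eq t _)
  have hdens : ∀ t, 0 < t → IsDensity P (fun ω => ofBlocks I fun j => Zb j t ω) (f t) :=
    fun t ht => ⟨(hf t ht).2.2.continuous.measurable, (hf t ht).1,
      ⟨(hZm t).aemeasurable, (hf t ht).2.1⟩⟩
  have hsmooth : ∀ t, 0 < t → ContDiff ℝ 1 (f t) := fun t ht =>
    (hf t ht).2.2.of_le (by exact_mod_cast le_top)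
  refine ⟨⟨f, fun t ht => ⟨hdens t ht, (hf t ht).2.2⟩, d * C, by positivity, fun j => ?_⟩,
    fun k => α (J k), ha, fun k => hα (J k), f, hdens, C, hC, fun k h => ?_⟩
  · filter_upwards [Filter.eventually_all.mpr hfC, self_mem_nhdsWithin] with t hft ht
    obtain ⟨h1, h2⟩ := integrable_partialGrad_of_integrable (I j) (hsmooth t ht)
      (B := C * (t : ℝ) ^ (-1 / α j)) (fun k _ => (hft k).1)
      fun k hk => by
        have := (hft k).2
        rwa [ha j k hk] at this
    refine ⟨h1, h2.trans ?_⟩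
    rw [mul_assoc]
    gcongr
    have := Finset.card_le_univ (I j)
    rwa [Fintype.card_fin] at this
  · refine limsup_le_of_le (by isBoundedDefault) ?_
    filter_upwards [hfC k, self_mem_nhdsWithin] with t hft ht
    have ht' : (0 : ℝ) < t := ht
    calc ENNReal.ofReal ((t : ℝ) ^ (1 / α (J k))) *
          ∫⁻ z, ENNReal.ofReal |f t (z + EuclideanSpace.single k h) - f t z|
        ≤ ENNReal.ofReal ((t : ℝ) ^ (1 / α (J k))) *
          ENNReal.ofReal (|h| * (C * (t : ℝ) ^ (-1 / α (J k)))) := by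
          gcongr
          exact lintegral_translate_single_le (hsmooth t ht) hft.1 hft.2 h
      _ = ENNReal.ofReal (C * |h|) := by
          rw [← ENNReal.ofReal_mul (by positivity)]
          congr 1
          have h1 : (t : ℝ) ^ (1 / α (J k)) * (t : ℝ) ^ (-1 / α (J k)) = 1 := by
            rw [← Real.rpow_add ht', neg_div, add_neg_cancel, Real.rpow_zero]
          linear_combination (|h| * C) * h1
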